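/- For $g\in L^2(\mathbb{R})$ (complex-valued) and $\Lambda\subset\mathbb{R}^2$ let $G(g,\Lambda)=\{e^{2\pi i\mu t}g(t-\lambda)\}_{(\lambda,\mu)\in\Lambda}$ be the Gabor system generated by $g$ and $\Lambda$. Let $\phi(t)=(2/\pi)^{1/4}e^{-t^2}$, so that $\|\phi\|_{L^2(\mathbb{R})}=1$, and let $$V_\phi g(x,y)=\int_{\mathbb{R}}g(t)\,\overline{\phi(t-x)}\,e^{-2\pi i yt}\,dt .$$ For $(a,b)\in\mathbb{R}^2$ and $R\in\mathbb{R}$ let $Q_{(a,b)}(R)=\{(x,y)\in\mathbb{R}^2: |x-a|\le R,\ |y-b|\le R\}$, let $Q_0(R)=Q_{(0,0)}(R)$ and $Q_0^c(R)=\mathbb{R}^2\setminus Q_0(R)$, and for $G\in L^2(\mathbb{R}^2)$ and $R\ge 0$ put $$I_G(R)=\int_{Q_0(R)}\int_{Q_0^c(R+\frac14)}|G(t-x,s-y)|^2\,dt\,ds\,dx\,dy .$$ A family $\{f_n\}$ in a Hilbert space $H$ is a Riesz sequence with bounds $A,B>0$ if for every $\{a_n\}\in\ell^2$ the series $\sum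 a_nf_n$ converges and $A\sum|a_n|^2\le\|\sum a_nf_n\|^2\le B\sum|a_n|^2$; it is a frame with bounds $A,B>0$ if $A\|f\|^2\le\sum|\langle f,f_n\rangle|^2\le B\|f\|^2$ for every $f\in H$. Theorem. For all $\delta,A,B>0$ there is a constant $C>0$, depending only on $\delta$, $A$ and $B$, such that the following holds for every $g\in L^2(\mathbb{R})$ and every $\Lambda\subset\mathbb{R}^2$ that is uniformly discrete with separation constant $\delta$ (any two distinct points of $\Lambda$ are at Euclidean distance greater than $\delta$). Write $G=V_\phi g$. 1. If $G(g,\Lambda)$ is a Riesz sequence in $L^2(\mathbb{R})$ with bounds $A,B$, then for every $R>0$ $$\sup_{(a,b)\in\mathbb{R}^2}|\Lambda\cap Q_{(a,b)}(R)|\le(2R+1)^2+C\,I_G\!\left(R+\tfrac14\right).$$ 2. If $G(g,\Lambda)$ is a frame in $L^2(\mathbb{R})$ with bounds $A,B$, then for every $R\ge\frac12$ $$\inf_{(a,b)\in\mathbb{R}^2}|\Lambda\cap Q_{(a,b)}(R)|\ge(2R-1)^2-C\,I_G\!\left(R-\tfrac12\right).$$ (The sets $\Lambda\cap Q_{(a,b)}(R)$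 are finite.) -/

import Mathlib

open MeasureTheory

namespace GaborDensity

noncomputable section

/-- The Hilbert space `L²(ℝ)` of complex-valued square integrable functions. -/
abbrev L2R : Type := Lp ℂ 2 (volume : Measure ℝ)

/-- The pointwise formula for the time-frequency shift of a square integrable function is again
square integrable. -/
theorem memLp_timeFreqShift (a b : ℝ) (g : L2R) :
    MemLp (fun t : ℝ => Complex.exp (2 * Real.pi * Complex.I * b * t) * g (t - a)) 2 volume := by
  have h1 : MemLp (fun t : ℝ => g (t - a)) 2 volume :=
    (Lp.memLp g).comp_measurePreserving (measurePreserving_sub_right volume a)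
  have hc : Continuous (fun t : ℝ => Complex.exp (2 * Real.pi * Complex.I * b * t)) := by
    fun_prop
  refine h1.of_le (hc.aestronglyMeasurable.mul h1.aestronglyMeasurable) ?_
  refine Filter.Eventually.of_forall (fun t => ?_)
  have h2 : (2 * Real.pi * Complex.I * b * t : ℂ) = ((2 * Real.pi * b * t : ℝ) : ℂ) * Complex.I := by
    push_cast
    ring
  rw [norm_mul, h2, Complex.norm_exp_ofReal_mul_I, one_mul]

/-- The time-frequency shift `t ↦ e^{2πibt} g(t - a)`, as an element of `L²(ℝ)`. -/
def timeFreqShift (a b : ℝ) (g : L2R) : L2R :=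
  (memLp_timeFreqShift a b g).toLp

/-- The Gabor system generated by `g` and `Λ`: the family, indexed by the points `(λ, μ)` of `Λ`,
of the functions `t ↦ e^{2πiμt} g(t - λ)`. -/
def gaborSystem (g : L2R) (Λ : Set (ℝ × ℝ)) : Λ → L2R :=
  fun p => timeFreqShift p.1.1 p.1.2 g

/-- The Gaussian window `t ↦ (2/π)^{1/4} e^{-t²}`, which has `L²`-norm one. -/
def gaussianWindow (t : ℝ) : ℂ :=
  (((2 / Real.pi) ^ (1 / 4 : ℝ) * Real.exp (-t ^ 2) : ℝ) : ℂ)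

/-- The window is normalized in `L²(ℝ)`. -/
theorem integral_norm_sq_gaussianWindow : ∫ t : ℝ, ‖gaussianWindow t‖ ^ 2 = 1 := by
  have h : ∀ t : ℝ, ‖gaussianWindow t‖ ^ 2
      = (2 / Real.pi) ^ (1 / 2 : ℝ) * Real.exp (-2 * t ^ 2) := by
    intro t
    have h0 : (0 : ℝ) ≤ 2 / Real.pi := by positivity
    rw [gaussianWindow, Complex.norm_real, Real.norm_eq_abs, sq_abs, mul_pow, ← Real.rpow_natCast,
      ← Real.rpow_mul h0, ← Real.exp_nat_mul]
    norm_num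
  simp_rw [h]
  rw [integral_const_mul, integral_gaussian, ← Real.sqrt_eq_rpow, ← Real.sqrt_mul (by positivity)]
  have hp := Real.pi_ne_zero
  rw [show 2 / Real.pi * (Real.pi / 2) = 1 by field_simp]
  exact Real.sqrt_one

/-- The short-time Fourier transform with window `φ`:
`V_φ g (x, y) = ∫ g(t) conj(φ(t - x)) e^{-2πiyt} dt`. -/
def stft (φ : ℝ → ℂ) (g : L2R) (z : ℝ × ℝ) : ℂ :=
  ∫ t : ℝ, g t * (starRingEnd ℂ) (φ (t - z.1)) *
    Complex.exp (-(2 * Real.pi * Complex.I * z.2 * t))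

/-- The closed square with centre `c` and side length `2R`. -/
def cube (c : ℝ × ℝ) (R : ℝ) : Set (ℝ × ℝ) :=
  {p | |p.1 - c.1| ≤ R ∧ |p.2 - c.2| ≤ R}

/-- `Λ ⊆ ℝ²` is uniformly discrete with separation constant `δ`: distinct points of `Λ` are at
Euclidean distance greater than `δ` (the distance is written out because the product metric of
`ℝ × ℝ` is the maximum metric). -/
def HasSeparation (Λ : Set (ℝ × ℝ)) (δ : ℝ) : Prop :=
  ∀ p ∈ Λ, ∀ q ∈ Λ, p ≠ q → δ < √((p.1 - q.1) ^ 2 + (p.2 - q.2) ^ 2)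

/-- The family `f` is a Riesz sequence with bounds `A` and `B`: for every `a ∈ ℓ²` the series
`∑ aₙ fₙ` converges and `A ∑ |aₙ|² ≤ ‖∑ aₙ fₙ‖² ≤ B ∑ |aₙ|²`. -/
def IsRieszSequence {ι H : Type*} [NormedAddCommGroup H] [InnerProductSpace ℂ H]
    (f : ι → H) (A B : ℝ) : Prop :=
  ∀ a : ι → ℂ, Summable (fun n => ‖a n‖ ^ 2) →
    Summable (fun n => a n • f n) ∧
    A * ∑' n, ‖a n‖ ^ 2 ≤ ‖∑' n, a n • f n‖ ^ 2 ∧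
    ‖∑' n, a n • f n‖ ^ 2 ≤ B * ∑' n, ‖a n‖ ^ 2

/-- The family `f` is a frame with bounds `A` and `B`: for every `h ∈ H` the series
`∑ |⟨h, fₙ⟩|²` converges and `A ‖h‖² ≤ ∑ |⟨h, fₙ⟩|² ≤ B ‖h‖²`. -/
def IsFrame {ι H : Type*} [NormedAddCommGroup H] [InnerProductSpace ℂ H]
    (f : ι → H) (A B : ℝ) : Prop :=
  ∀ h : H, Summable (fun n => ‖inner ℂ (f n) h‖ ^ 2) ∧
    A * ‖h‖ ^ 2 ≤ ∑' n, ‖inner ℂ (f n) h‖ ^ 2 ∧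
    ∑' n, ‖inner ℂ (f n) h‖ ^ 2 ≤ B * ‖h‖ ^ 2

/-- `I_G(R)`: the integral of `|G(q - p)|²` over `p` in the cube `Q₀(R)` and `q` in the complement
of the cube `Q₀(R + 1/4)`. For `G ∈ L²(ℝ²)` both integrals converge absolutely. -/
def crossIntegral (G : ℝ × ℝ → ℂ) (R : ℝ) : ℝ :=
  ∫ p in cube 0 R, ∫ q in (cube 0 (R + 1 / 4))ᶜ, ‖G (q - p)‖ ^ 2

end

end GaborDensity

/-! The proof compares dimensions with phase-space areas. Let `x_z` be the Gaussian atom at `z`.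
Since `V_φ` is an isometry, a finite-dimensional `V` with orthogonal projection `P` satisfies `∫ ‖P
x_z‖² dz = dim V` (`lintegral_enorm_starProjection_gaussianAtom`), while `|⟨x_z, g_p⟩| = |G(z - p)|`
for the Gabor element `g_p` at `p`.

Riesz case: `V` is spanned by the elements with `p` in the cube of radius `R`, so `dim V` is the
number of points. On the cube of radius `R + 1/2` the integrand is at most `1`, which gives `(2R +
1)²`. Outside it, `A ‖P x‖² ≤ ∑ |⟨g_p, x⟩|²` over these `p`.

Frame case: `V` is spanned by the canonical dual elements of the points in the cube, and `A ‖x - P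
x‖²` is at most the sum over the points outside (`IsFrame.exists_submodule`). Integrating `1 = ‖P
x_z‖² + ‖x_z - P x_z‖²` over the cube of radius `R - 1/2` bounds `(2R - 1)²`.

In both cases the error is a sum over points of integrals of `|G(z - p)|²`. Up to a Gaussian factor
`G` is an entire function, so `|G|²` is controlled by its averages over small ellipses
(`enorm_stft_sq_le`). By separation these ellipses are disjoint, and the sum becomes a cross
integral (`sum_lintegral_stft_sub_le`). -/

open scoped FourierTransform ENNReal

namespace GaborDensity

/-! ### Projections attached to Riesz sequences and frames in a Hilbert space. -/

section Hilbert

variable {ι H : Type*} [NormedAddCommGroup H] [InnerProductSpace ℂ H] {f : ι → H} {A B : ℝ}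

theorem norm_starProjection_sq (V : Submodule ℂ H) [V.HasOrthogonalProjection] (x : H) :
    ((‖V.starProjection x‖ ^ 2 : ℝ) : ℂ) = inner ℂ (V.starProjection x) x := by
  have h : inner ℂ (V.starProjection x) x
      = inner ℂ (V.starProjection x) (V.starProjection x) := by
    rw [← Submodule.inner_starProjection_left_eq_right,
      Submodule.starProjection_eq_self_iff.2 (V.starProjection_apply_mem x)]
  rw [h, inner_self_eq_norm_sq_to_K]
  simp

theorem IsRieszSequence.le_norm_sum_sq (hf : IsRieszSequence f A B) (s : Finset ι) (a : ι → ℂ) :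
    A * ∑ n ∈ s, ‖a n‖ ^ 2 ≤ ‖∑ n ∈ s, a n • f n‖ ^ 2 := by
  classical
  have h0 : ∀ n ∉ s, (fun n => if n ∈ s then a n else 0) n = 0 := fun n hn => by simp [hn]
  have h1 : ∀ n ∉ s, ‖(fun n => if n ∈ s then a n else 0) n‖ ^ 2 = 0 := fun n hn => by simp [hn]
  have h2 : ∀ n ∉ s, (fun n => if n ∈ s then a n else 0) n • f n = 0 := fun n hn => by simp [hn]
  obtain ⟨-, h, -⟩ := hf (fun n => if n ∈ s then a n else 0) (summable_of_ne_finset_zero h1)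
  rw [tsum_eq_sum h1, tsum_eq_sum h2] at h
  have e1 : ∑ n ∈ s, ‖(fun n => if n ∈ s then a n else 0) n‖ ^ 2 = ∑ n ∈ s, ‖a n‖ ^ 2 :=
    Finset.sum_congr rfl fun n hn => by simp [hn]
  have e2 : ∑ n ∈ s, (fun n => if n ∈ s then a n else 0) n • f n = ∑ n ∈ s, a n • f n :=
    Finset.sum_congr rfl fun n hn => by simp [hn]
  rwa [e1, e2] at h

theorem IsRieszSequence.le_norm_sum_attach_sq (hf : IsRieszSequence f A B) (s : Finset ι)
    (c : s → ℂ) : A * ∑ n, ‖c n‖ ^ 2 ≤ ‖∑ n, c n • f n‖ ^ 2 := by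
  classical
  have h := hf.le_norm_sum_sq s (fun n => if hn : n ∈ s then c ⟨n, hn⟩ else 0)
  have e1 := Finset.sum_coe_sort s (fun n => ‖if hn : n ∈ s then c ⟨n, hn⟩ else 0‖ ^ 2)
  have e2 := Finset.sum_coe_sort s (fun n => (if hn : n ∈ s then c ⟨n, hn⟩ else 0) • f n)
  rw [← e1, ← e2] at h
  have e3 : ∀ n : s, (if hn : (n : ι) ∈ s then c ⟨n, hn⟩ else 0) = c n := fun n => dif_pos n.2
  simp_rw [e3] at h
  exact h

theorem IsRieszSequence.finrank_span (hA : 0 < A) (hf : IsRieszSequence f A B) (s : Finset ι) :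
    Module.finrank ℂ (Submodule.span ℂ (Set.range fun n : s => f n)) = s.card := by
  have hli : LinearIndependent ℂ (fun n : s => f n) := by
    rw [Fintype.linearIndependent_iff]
    intro c hc n
    have h := hf.le_norm_sum_attach_sq s c
    rw [hc, norm_zero, zero_pow two_ne_zero] at h
    have h1 : ∑ n, ‖c n‖ ^ 2 ≤ 0 := by
      by_contra hlt
      push Not at hlt
      nlinarith [mul_pos hA hlt]
    have h2 : ‖c n‖ ^ 2 ≤ ∑ n, ‖c n‖ ^ 2 :=
      Finset.single_le_sum (f := fun n => ‖c n‖ ^ 2) (fun _ _ => by positivity) (Finset.mem_univ n)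
    have h3 : ‖c n‖ ^ 2 = 0 := le_antisymm (h2.trans h1) (by positivity)
    simpa using h3
  rw [finrank_span_eq_card hli, Fintype.card_coe]

/-- Write `P x = ∑ cₙ fₙ`. Then `‖P x‖² = ⟨P x, x⟩` is bounded by Cauchy–Schwarz, and the lower
Riesz bound controls `∑ |cₙ|²` by `‖P x‖² / A`. -/
theorem IsRieszSequence.norm_starProjection_sq_le (hf : IsRieszSequence f A B)
    (s : Finset ι) (x : H) :
    haveI : FiniteDimensional ℂ (Submodule.span ℂ (Set.range fun n : s => f n)) :=
      FiniteDimensional.span_of_finite ℂ (Set.finite_range _)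
    A * ‖(Submodule.span ℂ (Set.range fun n : s => f n)).starProjection x‖ ^ 2
      ≤ ∑ n ∈ s, ‖inner ℂ (f n) x‖ ^ 2 := by
  have : FiniteDimensional ℂ (Submodule.span ℂ (Set.range fun n : s => f n)) :=
    FiniteDimensional.span_of_finite ℂ (Set.finite_range _)
  set V := Submodule.span ℂ (Set.range fun n : s => f n)
  obtain ⟨c, hc⟩ := (Submodule.mem_span_range_iff_exists_fun ℂ).1
    (V.starProjection_apply_mem x)
  have hlow := hf.le_norm_sum_attach_sq s c
  rw [hc] at hlow
  have hns := norm_starProjection_sq V x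
  have hle : ‖V.starProjection x‖ ^ 2 ≤ ∑ n : s, ‖c n‖ * ‖inner ℂ (f n) x‖ := by
    rw [← hc, sum_inner] at hns
    rw [hc] at hns
    calc ‖V.starProjection x‖ ^ 2 = ‖((‖V.starProjection x‖ ^ 2 : ℝ) : ℂ)‖ := by
          rw [Complex.norm_real, Real.norm_of_nonneg (by positivity)]
      _ ≤ ∑ n : s, ‖inner ℂ (c n • f n) x‖ := by rw [hns]; exact norm_sum_le _ _
      _ = _ := Finset.sum_congr rfl fun n _ => by rw [inner_smul_left, norm_mul, RCLike.norm_conj]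
  have hcs := Finset.sum_mul_sq_le_sq_mul_sq Finset.univ (fun n : s => ‖c n‖)
    (fun n : s => ‖inner ℂ (f n) x‖)
  rw [← Finset.sum_coe_sort]
  set X := ∑ n : s, ‖inner ℂ (f n) x‖ ^ 2 with hX
  have hX0 : 0 ≤ X := Finset.sum_nonneg fun _ _ => by positivity
  set p := ‖V.starProjection x‖ ^ 2
  have hp0 : 0 ≤ p := by positivity
  rcases hp0.eq_or_lt with h | h
  · rw [← h, mul_zero]; exact hX0
  rcases le_or_gt A 0 with hA | hA
  · nlinarith
  have h1 : p ^ 2 ≤ (∑ n : s, ‖c n‖ ^ 2) * X := (pow_le_pow_left₀ hp0 hle 2).trans hcs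
  have h2 : A * p ^ 2 ≤ p * X := by
    calc A * p ^ 2 ≤ A * ((∑ n : s, ‖c n‖ ^ 2) * X) := by gcongr
      _ = (A * ∑ n : s, ‖c n‖ ^ 2) * X := by ring
      _ ≤ p * X := by gcongr
  nlinarith

/-- The analysis operator of a frame. -/
noncomputable def IsFrame.analysis (hf : IsFrame f A B) : H →L[ℂ] lp (fun _ : ι => ℂ) 2 :=
  LinearMap.mkContinuous
    { toFun := fun h => ⟨fun n => inner ℂ (f n) h, by
        refine memℓp_gen ?_
        simpa using (hf h).1⟩
      map_add' := fun x y => by ext n; exact inner_add_right _ _ _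
      map_smul' := fun c x => by ext n; exact inner_smul_right _ _ _ }
    (√B) (fun h => by
      have h1 := (hf h).2.2
      refine abs_le_of_sq_le_sq' ?_ (by positivity) |>.2
      have h2 := lp.norm_rpow_eq_tsum (p := 2) (by simp)
        (⟨fun n => inner ℂ (f n) h, memℓp_gen (by simpa using (hf h).1)⟩ : lp (fun _ : ι => ℂ) 2)
      simp only [ENNReal.toReal_ofNat, Real.rpow_ofNat] at h2
      have h3 : B * ‖h‖ ^ 2 ≤ (√B * ‖h‖) ^ 2 := by
        rw [mul_pow]
        gcongr
        -- For negative `B` the value `√B` is `0`, and the inequality still holds.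
        rcases le_or_gt 0 B with hB | hB
        · rw [Real.sq_sqrt hB]
        · exact hB.le.trans (by positivity)
      exact h2.le.trans (h1.trans h3))

theorem IsFrame.analysis_apply (hf : IsFrame f A B) (h : H) (n : ι) :
    hf.analysis h n = inner ℂ (f n) h := rfl

theorem lp_two_norm_sq (a : lp (fun _ : ι => ℂ) 2) : ‖a‖ ^ 2 = ∑' n, ‖a n‖ ^ 2 := by
  have h2 := lp.norm_rpow_eq_tsum (p := 2) (by simp) a
  simpa using h2

theorem IsFrame.adjoint_analysis_single [CompleteSpace H] [DecidableEq ι] (hf : IsFrame f A B)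
    (n : ι) (c : ℂ) :
    ContinuousLinearMap.adjoint hf.analysis (lp.single 2 n c) = c • f n := by
  refine ext_inner_right ℂ fun y => ?_
  rw [ContinuousLinearMap.adjoint_inner_left, lp.inner_single_left, hf.analysis_apply,
    inner_smul_left, RCLike.inner_apply, mul_comm]

/-- With analysis operator `T` and frame operator `S = T* T`, take `V = S⁻¹ span {fₙ : n ∈ s}`.
Split `T x = a + b` with `b` supported on `s`. Then `x = S⁻¹ T* a + S⁻¹ T* b`, the second term lies
in `V`, and `T S⁻¹ T*` is a contraction, so `A ‖S⁻¹ T* a‖² ≤ ‖a‖²`. -/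
theorem IsFrame.exists_submodule [CompleteSpace H] (hA : 0 < A) (hf : IsFrame f A B)
    (s : Finset ι) :
    ∃ V : Submodule ℂ H, ∃ _ : FiniteDimensional ℂ V, Module.finrank ℂ V ≤ s.card ∧
      ∀ x, A * ‖x - V.starProjection x‖ ^ 2 ≤ ∑' n : {n // n ∉ s}, ‖inner ℂ (f n) x‖ ^ 2 := by
  classical
  set T := hf.analysis with hT
  set S : H →L[ℂ] H := (ContinuousLinearMap.adjoint T).comp T with hS
  have hTlow : ∀ x, A * ‖x‖ ^ 2 ≤ ‖T x‖ ^ 2 := fun x => by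
    rw [lp_two_norm_sq]
    exact (hf x).2.1
  have hSin : ∀ x y, inner ℂ (S x) y = inner ℂ (T x) (T y) := fun x y => by
    rw [hS, ContinuousLinearMap.comp_apply, ContinuousLinearMap.adjoint_inner_left]
  have hunit : IsUnit S := by
    refine ContinuousLinearMap.isUnit_of_forall_le_norm_inner_map S (c := ⟨A, hA.le⟩) hA fun x => ?_
    rw [hSin, inner_self_eq_norm_sq_to_K]
    have h := hTlow x
    rw [mul_comm] at h
    change ‖x‖ ^ 2 * A ≤ _
    simpa using h
  rw [ContinuousLinearMap.isUnit_iff_bijective] at hunit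
  let e : H ≃ₗ[ℂ] H := LinearEquiv.ofBijective S.toLinearMap hunit
  have hSe : ∀ u, S (e.symm u) = u := fun u => e.apply_symm_apply u
  set V0 : Submodule ℂ H := Submodule.span ℂ (Set.range fun n : s => f n)
  have : FiniteDimensional ℂ V0 := FiniteDimensional.span_of_finite ℂ (Set.finite_range _)
  refine ⟨V0.map (e.symm : H →ₗ[ℂ] H), inferInstance, ?_, fun x => ?_⟩
  · refine (Submodule.finrank_map_le _ _).trans ?_
    simpa [Set.finrank] using finrank_range_le_card (R := ℂ) (fun n : s => f n)
  set V := V0.map (e.symm : H →ₗ[ℂ] H)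
  set b : lp (fun _ : ι => ℂ) 2 := ∑ n ∈ s, lp.single 2 n (T x n) with hb
  set a := T x - b with ha
  have hbV : e.symm (ContinuousLinearMap.adjoint T b) ∈ V := by
    refine Submodule.mem_map_of_mem ?_
    rw [hb, map_sum]
    refine Submodule.sum_mem _ fun n hn => ?_
    rw [hf.adjoint_analysis_single]
    exact Submodule.smul_mem _ _ (Submodule.subset_span ⟨⟨n, hn⟩, rfl⟩)
  set k := e.symm (ContinuousLinearMap.adjoint T a) with hk
  have hxk : x - e.symm (ContinuousLinearMap.adjoint T b) = k := by
    rw [hk, ha, map_sub, map_sub]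
    congr 1
    exact (e.symm_apply_apply x).symm
  -- The projection is the nearest point of `V`, so it does at least as well as `S⁻¹ T* b`.
  have hdist : ‖x - V.starProjection x‖ ≤ ‖k‖ := by
    rw [Submodule.starProjection_minimal, ← hxk]
    exact ciInf_le ⟨0, by rintro _ ⟨y, rfl⟩; positivity⟩
      (⟨_, hbV⟩ : V)
  have hTk : ‖T k‖ ≤ ‖a‖ := by
    have h1 : ‖T k‖ ^ 2 ≤ ‖a‖ * ‖T k‖ := by
      have h2 : inner ℂ (T k) (T k) = inner ℂ a (T k) := by
        rw [← hSin, hk, hSe, ContinuousLinearMap.adjoint_inner_left]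
      have h3 : ‖inner ℂ (T k) (T k)‖ = ‖T k‖ ^ 2 := by
        rw [inner_self_eq_norm_sq_to_K]; simp
      rw [← h3, h2]
      exact norm_inner_le_norm _ _
    rcases (norm_nonneg (T k)).eq_or_lt with h | h
    · rw [← h]; positivity
    · nlinarith
  have han : ∀ n, a n = if n ∈ s then 0 else inner ℂ (f n) x := fun n => by
    have hbn : b n = if n ∈ s then T x n else 0 := by
      rw [hb, lp.coeFn_sum, Finset.sum_apply]
      simp only [lp.single_apply, Finset.sum_pi_single]
    rw [ha, lp.coeFn_sub, Pi.sub_apply, hbn]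
    split_ifs
    · simp
    · rw [sub_zero]; rfl
  calc A * ‖x - V.starProjection x‖ ^ 2 ≤ A * ‖k‖ ^ 2 := by gcongr
    _ ≤ ‖T k‖ ^ 2 := hTlow k
    _ ≤ ‖a‖ ^ 2 := by gcongr
    _ = ∑' n, ‖a n‖ ^ 2 := lp_two_norm_sq a
    _ = ∑' n, Set.indicator {n | n ∉ s} (fun n => ‖inner ℂ (f n) x‖ ^ 2) n := by
      refine tsum_congr fun n => ?_
      rw [han]
      by_cases hn : n ∈ s <;> simp [hn]
    _ = _ := (tsum_subtype {n | n ∉ s} _).symm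

end Hilbert

/-! ### Plancherel for the Fourier integral on `L¹ ∩ L²`. -/

theorem enorm_sq_eq_lintegral (u : L2R) : ‖u‖ₑ ^ 2 = ∫⁻ y, ‖u y‖ₑ ^ 2 := by
  rw [Lp.enorm_def, eLpNorm_eq_lintegral_rpow_enorm_toReal (by simp) (by simp),
    ← ENNReal.rpow_natCast, ← ENNReal.rpow_mul]
  simp

/-- Both sides have the same integrals against test functions: the `L²` transform agrees with the
distributional one, and the Fourier integral satisfies the multiplication formula. -/
theorem fourier_ae_eq_Lp_fourier {k : ℝ → ℂ} (h1 : Integrable k) (h2 : MemLp k 2) :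
    (𝓕 (h2.toLp k) : Lp ℂ 2 (volume : Measure ℝ)) =ᵐ[volume] 𝓕 k := by
  refine ae_eq_of_integral_contDiff_smul_eq
    ((Lp.memLp _).locallyIntegrable (by norm_num)) ?_ fun s hs hsc => ?_
  · exact (VectorFourier.fourierIntegral_continuous Real.continuous_fourierChar
      (innerSL ℝ).continuous₂ h1).locallyIntegrable
  have hs1 : ContDiff ℝ (⊤ : ℕ∞) (fun x => (s x : ℂ)) := Complex.ofRealCLM.contDiff.comp hs
  have hs2 : HasCompactSupport (fun x => (s x : ℂ)) := hsc.comp_left (g := Complex.ofReal) rfl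
  set σ : SchwartzMap ℝ ℂ := hs2.toSchwartzMap hs1 with hσ
  have hσs : ∀ x, σ x = s x := fun x => rfl
  have e1 := congrArg (fun T : TemperedDistribution ℝ ℂ => T σ)
    (Lp.fourier_toTemperedDistribution_eq (h2.toLp k))
  simp only [TemperedDistribution.fourier_apply, Lp.toTemperedDistribution_apply] at e1
  have e2 : ∫ x, (𝓕 σ) x • (h2.toLp k) x = ∫ x, (𝓕 σ) x • k x := by
    refine integral_congr_ae ?_
    filter_upwards [h2.coeFn_toLp] with x hx
    rw [hx]
  have e3 := VectorFourier.integral_fourierIntegral_smul_eq_flip (L := innerₗ ℝ)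
    (μ := volume) (ν := volume) Real.continuous_fourierChar continuous_inner σ.integrable h1
  rw [flip_innerₗ] at e3
  have e4 : ∀ x, s x • (𝓕 k) x = σ x • (𝓕 k) x := fun x => by rw [hσs]; simp
  have e5 : ∀ x, s x • (𝓕 (h2.toLp k) : Lp ℂ 2 (volume : Measure ℝ)) x
    = σ x • (𝓕 (h2.toLp k) : Lp ℂ 2 (volume : Measure ℝ)) x := fun x => by rw [hσs]; simp
  simp_rw [e4, e5]
  rw [← e1, e2]
  exact e3

theorem lintegral_enorm_fourier_sq {k : ℝ → ℂ} (h1 : Integrable k) (h2 : MemLp k 2) :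
    ∫⁻ y, ‖𝓕 k y‖ₑ ^ 2 = ∫⁻ t, ‖k t‖ₑ ^ 2 := by
  have h3 := (enorm_sq_eq_lintegral (𝓕 (h2.toLp k))).symm
  have h4 := (enorm_sq_eq_lintegral (h2.toLp k)).symm
  have h5 : ‖(𝓕 (h2.toLp k) : Lp ℂ 2 (volume : Measure ℝ))‖ₑ = ‖h2.toLp k‖ₑ := by
    rw [← ofReal_norm, ← ofReal_norm, Lp.norm_fourier_eq]
  rw [h5, ← h4] at h3
  rw [lintegral_congr_ae (g := fun y => ‖(𝓕 (h2.toLp k) : Lp ℂ 2 (volume : Measure ℝ)) y‖ₑ ^ 2),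
    h3]
  · refine lintegral_congr_ae ?_
    filter_upwards [h2.coeFn_toLp] with x hx
    rw [hx]
  · filter_upwards [fourier_ae_eq_Lp_fourier h1 h2] with x hx
    rw [hx]

/-! ### Gaussian atoms and the isometry property of the short-time Fourier transform. -/

theorem gaussianWindow_eq (t : ℝ) : gaussianWindow t =
    (((2 / Real.pi) ^ (1 / 4 : ℝ) : ℝ) : ℂ) * Complex.exp (-(t : ℂ) ^ 2) := by
  rw [gaussianWindow]
  push_cast
  rfl

theorem continuous_gaussianWindow : Continuous gaussianWindow := by
  simp_rw [funext gaussianWindow_eq]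
  fun_prop

theorem conj_gaussianWindow (t : ℝ) : (starRingEnd ℂ) (gaussianWindow t) = gaussianWindow t := by
  rw [gaussianWindow, Complex.conj_ofReal]

theorem memLp_gaussianWindow : MemLp gaussianWindow 2 volume := by
  rw [memLp_two_iff_integrable_sq_norm continuous_gaussianWindow.aestronglyMeasurable]
  by_contra h
  have h1 := integral_norm_sq_gaussianWindow
  rw [integral_undef h] at h1
  exact zero_ne_one h1

/-- The Gaussian window as an element of `L²(ℝ)`. -/
noncomputable def gaussianL2 : L2R := memLp_gaussianWindow.toLp

theorem lintegral_enorm_gaussianWindow_sq : ∫⁻ t : ℝ, ‖gaussianWindow t‖ₑ ^ 2 = 1 := by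
  have h := ofReal_integral_eq_lintegral_ofReal
    ((memLp_two_iff_integrable_sq_norm continuous_gaussianWindow.aestronglyMeasurable).1
      memLp_gaussianWindow) (Filter.Eventually.of_forall fun t => by positivity)
  rw [integral_norm_sq_gaussianWindow, ENNReal.ofReal_one] at h
  rw [h]
  refine lintegral_congr fun t => ?_
  rw [ENNReal.ofReal_pow (norm_nonneg _), ofReal_norm]

theorem timeFreqShift_coeFn (a b : ℝ) (g : L2R) :
    timeFreqShift a b g =ᵐ[volume]
      fun t : ℝ => Complex.exp (2 * Real.pi * Complex.I * b * t) * g (t - a) :=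
  (memLp_timeFreqShift a b g).coeFn_toLp

theorem norm_exp_two_pi_I (b t : ℝ) : ‖Complex.exp (2 * Real.pi * Complex.I * b * t)‖ = 1 := by
  have h2 : (2 * Real.pi * Complex.I * b * t : ℂ) = ((2 * Real.pi * b * t : ℝ) : ℂ) * Complex.I := by
    push_cast
    ring
  rw [h2, Complex.norm_exp_ofReal_mul_I]

theorem enorm_timeFreqShift_sq (a b : ℝ) (g : L2R) : ‖timeFreqShift a b g‖ₑ ^ 2 = ‖g‖ₑ ^ 2 := by
  rw [enorm_sq_eq_lintegral, enorm_sq_eq_lintegral,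
    ← lintegral_sub_right_eq_self (fun t => ‖g t‖ₑ ^ 2) a]
  refine lintegral_congr_ae ?_
  filter_upwards [timeFreqShift_coeFn a b g] with t ht
  rw [ht, enorm_mul, ← ofReal_norm (Complex.exp _), norm_exp_two_pi_I, ENNReal.ofReal_one, one_mul]

theorem enorm_gaussianL2_sq : ‖gaussianL2‖ₑ ^ 2 = 1 := by
  rw [enorm_sq_eq_lintegral, ← lintegral_enorm_gaussianWindow_sq]
  refine lintegral_congr_ae ?_
  filter_upwards [memLp_gaussianWindow.coeFn_toLp] with t ht
  rw [gaussianL2, ht]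

/-- The time-frequency shift of the Gaussian window to the point `z`. -/
noncomputable def gaussianAtom (z : ℝ × ℝ) : L2R := timeFreqShift z.1 z.2 gaussianL2

theorem enorm_gaussianAtom_sq (z : ℝ × ℝ) : ‖gaussianAtom z‖ₑ ^ 2 = 1 := by
  rw [gaussianAtom, enorm_timeFreqShift_sq, enorm_gaussianL2_sq]

theorem inner_gaussianAtom (z : ℝ × ℝ) (f : L2R) :
    inner ℂ (gaussianAtom z) f = stft gaussianWindow f z := by
  rw [L2.inner_def, stft]
  refine integral_congr_ae ?_
  filter_upwards [timeFreqShift_coeFn z.1 z.2 gaussianL2,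
    (measurePreserving_sub_right volume z.1).quasiMeasurePreserving.ae
      memLp_gaussianWindow.coeFn_toLp] with t h1 h2
  rw [gaussianAtom, h1, gaussianL2, h2, RCLike.inner_apply, map_mul, ← Complex.exp_conj]
  have h3 : (starRingEnd ℂ) (2 * Real.pi * Complex.I * z.2 * t)
      = -(2 * Real.pi * Complex.I * z.2 * t) := by
    simp [Complex.conj_ofReal, map_ofNat (starRingEnd ℂ) 2]
  rw [h3]
  ring

/-- Time-frequency shifts compose up to a unimodular factor, here `c`, which the absolute value
removes. -/
theorem norm_inner_timeFreqShift_gaussianAtom (p z : ℝ × ℝ) (g : L2R) :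
    ‖inner ℂ (timeFreqShift p.1 p.2 g) (gaussianAtom z)‖ = ‖stft gaussianWindow g (z - p)‖ := by
  rw [norm_inner_symm, inner_gaussianAtom, stft, stft]
  set c : ℂ := Complex.exp (2 * Real.pi * Complex.I * ((p.2 - z.2 : ℝ) : ℂ) * p.1) with hc
  have h1 : ∫ t : ℝ, (timeFreqShift p.1 p.2 g) t * (starRingEnd ℂ) (gaussianWindow (t - z.1)) *
      Complex.exp (-(2 * Real.pi * Complex.I * z.2 * t))
      = ∫ t : ℝ, (fun s : ℝ => c * (g s * (starRingEnd ℂ) (gaussianWindow (s - (z - p).1)) *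
        Complex.exp (-(2 * Real.pi * Complex.I * (z - p).2 * s)))) (t - p.1) := by
    refine integral_congr_ae ?_
    filter_upwards [timeFreqShift_coeFn p.1 p.2 g] with t ht
    rw [ht, hc]
    have h2 : t - p.1 - (z - p).1 = t - z.1 := by simp
    have h3 : Complex.exp (2 * Real.pi * Complex.I * p.2 * t) *
        Complex.exp (-(2 * Real.pi * Complex.I * z.2 * t)) =
        Complex.exp (2 * Real.pi * Complex.I * ((p.2 - z.2 : ℝ) : ℂ) * p.1) *
        Complex.exp (-(2 * Real.pi * Complex.I * (z - p).2 * (t - p.1 : ℝ))) := by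
      rw [← Complex.exp_add, ← Complex.exp_add]
      congr 1
      simp only [Prod.snd_sub]
      push_cast
      ring
    simp only [h2]
    linear_combination (g (t - p.1) * (starRingEnd ℂ) (gaussianWindow (t - z.1))) * h3
  rw [h1, integral_sub_right_eq_self (fun s : ℝ => c * (g s * (starRingEnd ℂ)
    (gaussianWindow (s - (z - p).1)) * Complex.exp (-(2 * Real.pi * Complex.I * (z - p).2 * s)))),
    integral_const_mul, norm_mul, hc, norm_exp_two_pi_I, one_mul]

theorem measurable_stft (g : L2R) : Measurable (stft gaussianWindow g) := by
  have hg : Measurable g := (Lp.stronglyMeasurable g).measurable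
  have hφ : Measurable gaussianWindow := continuous_gaussianWindow.measurable
  have h : Measurable (fun q : (ℝ × ℝ) × ℝ => g q.2 * (starRingEnd ℂ) (gaussianWindow (q.2 - q.1.1))
      * Complex.exp (-(2 * Real.pi * Complex.I * q.1.2 * q.2))) := by
    simp_rw [conj_gaussianWindow]
    fun_prop
  exact h.stronglyMeasurable.integral_prod_right'.measurable

/-- For fixed `x` the transform is, in `y`, the Fourier transform of `f · φ(· - x)`. Plancherel in
`y`, Tonelli and `‖φ‖ = 1` give the result. -/
theorem lintegral_enorm_stft_sq (f : L2R) :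
    ∫⁻ z, ‖stft gaussianWindow f z‖ₑ ^ 2 = ‖f‖ₑ ^ 2 := by
  have hf : Measurable f := (Lp.stronglyMeasurable f).measurable
  have hφ : Measurable gaussianWindow := continuous_gaussianWindow.measurable
  have hM : Measurable (fun z => ‖stft gaussianWindow f z‖ₑ ^ 2) :=
    (measurable_stft f).enorm.pow_const 2
  have h1 : ∀ x : ℝ, ∫⁻ y : ℝ, ‖stft gaussianWindow f (x, y)‖ₑ ^ 2
      = ∫⁻ t : ℝ, ‖f t‖ₑ ^ 2 * ‖gaussianWindow (t - x)‖ₑ ^ 2 := by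
    intro x
    have hw : MemLp (fun t : ℝ => gaussianWindow (t - x)) 2 volume :=
      memLp_gaussianWindow.comp_measurePreserving (measurePreserving_sub_right volume x)
    have hk1 : Integrable (fun t : ℝ => f t * gaussianWindow (t - x)) :=
      (Lp.memLp f).integrable_mul hw
    -- The window is bounded by its value at `0`.
    have hk2 : MemLp (fun t : ℝ => f t * gaussianWindow (t - x)) 2 volume := by
      refine ((Lp.memLp f).const_mul (((2 / Real.pi) ^ (1 / 4 : ℝ) : ℝ) : ℂ)).of_le
        hk1.aestronglyMeasurable (Filter.Eventually.of_forall fun t => ?_)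
      rw [norm_mul, norm_mul, mul_comm]
      gcongr
      rw [gaussianWindow_eq, norm_mul]
      refine mul_le_of_le_one_right (norm_nonneg _) ?_
      rw [Complex.norm_exp, Real.exp_le_one_iff, ← Complex.ofReal_pow, ← Complex.ofReal_neg,
        Complex.ofReal_re]
      nlinarith [sq_nonneg (t - x)]
    have h := lintegral_enorm_fourier_sq hk1 hk2
    simp_rw [enorm_mul, mul_pow] at h
    rw [← h]
    refine lintegral_congr fun y => ?_
    congr 2
    rw [stft, Real.fourier_eq']
    refine integral_congr_ae (Filter.Eventually.of_forall fun t => ?_)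
    simp only [conj_gaussianWindow, smul_eq_mul, RCLike.inner_apply, conj_trivial]
    rw [mul_comm]
    congr 2
    push_cast
    ring
  rw [Measure.volume_eq_prod, lintegral_prod _ hM.aemeasurable]
  simp_rw [h1]
  rw [lintegral_lintegral_swap (by fun_prop)]
  rw [enorm_sq_eq_lintegral]
  refine lintegral_congr fun t => ?_
  rw [lintegral_const_mul _ (by fun_prop), lintegral_sub_left_eq_self
    (fun x => ‖gaussianWindow x‖ₑ ^ 2), lintegral_enorm_gaussianWindow_sq, mul_one]

/-! ### Local averages of the Gaussian short-time Fourier transform. -/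

theorem enorm_le_lintegral_circleMap {F : ℂ → ℂ} (hF : Differentiable ℂ F) (ρ : ℝ) :
    ENNReal.ofReal (2 * Real.pi) * ‖F 0‖ₑ
      ≤ ∫⁻ θ in Set.Ioo (-Real.pi) Real.pi, ‖F (circleMap 0 ρ θ)‖ₑ := by
  have h1 : Real.circleAverage F 0 ρ = F 0 := hF.diffContOnCl.circleAverage
  have h2 : ∫ θ in Set.Ioo (-Real.pi) Real.pi, F (circleMap 0 ρ θ) = (2 * Real.pi : ℝ) • F 0 := by
    rw [← h1, Real.circleAverage_def, smul_smul, mul_inv_cancel₀ (by positivity), one_smul]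
    -- Periodicity moves the angle from `(0, 2π)` to `(-π, π)`, the range used by `polarCoord`.
    have hper : Function.Periodic (fun θ => F (circleMap 0 ρ θ)) (2 * Real.pi) := fun θ => by
      simp only [periodic_circleMap 0 ρ θ]
    have h3 := hper.intervalIntegral_add_eq (-Real.pi) 0
    rw [zero_add, show -Real.pi + 2 * Real.pi = Real.pi by ring] at h3
    rw [← h3, intervalIntegral.integral_of_le (by linarith [Real.pi_pos]),
      integral_Ioc_eq_integral_Ioo]
  calc ENNReal.ofReal (2 * Real.pi) * ‖F 0‖ₑ = ‖(2 * Real.pi : ℝ) • F 0‖ₑ := by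
        rw [enorm_smul, Real.enorm_eq_ofReal (by positivity)]
    _ ≤ _ := by
        rw [← h2]
        exact enorm_integral_le_lintegral_enorm _

theorem enorm_le_lintegral_disc {F : ℂ → ℂ} (hF : Differentiable ℂ F) {r : ℝ} (hr : 0 < r) :
    ENNReal.ofReal (Real.pi * r ^ 2) * ‖F 0‖ₑ
      ≤ ∫⁻ p in {p : ℝ × ℝ | p.1 ^ 2 + p.2 ^ 2 < r ^ 2}, ‖F (p.1 + p.2 * Complex.I)‖ₑ := by
  have hFm : Measurable F := hF.continuous.measurable
  have hE : MeasurableSet {p : ℝ × ℝ | p.1 ^ 2 + p.2 ^ 2 < r ^ 2} :=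
    measurableSet_lt (by fun_prop) (by fun_prop)
  rw [← lintegral_indicator hE, ← lintegral_comp_polarCoord_symm, polarCoord_target,
    Measure.volume_eq_prod, ← Measure.prod_restrict, lintegral_prod]
  · have h1 : ∀ ρ ∈ Set.Ioo 0 r, ENNReal.ofReal ρ * (ENNReal.ofReal (2 * Real.pi) * ‖F 0‖ₑ) ≤
        ∫⁻ θ in Set.Ioo (-Real.pi) Real.pi, ENNReal.ofReal (ρ, θ).1 •
          Set.indicator {p : ℝ × ℝ | p.1 ^ 2 + p.2 ^ 2 < r ^ 2}
            (fun p => ‖F (p.1 + p.2 * Complex.I)‖ₑ) (polarCoord.symm (ρ, θ)) := by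
      intro ρ hρ
      have h2 : ∀ θ : ℝ, ENNReal.ofReal (ρ, θ).1 •
          Set.indicator {p : ℝ × ℝ | p.1 ^ 2 + p.2 ^ 2 < r ^ 2}
            (fun p => ‖F (p.1 + p.2 * Complex.I)‖ₑ) (polarCoord.symm (ρ, θ))
          = ENNReal.ofReal ρ * ‖F (circleMap 0 ρ θ)‖ₑ := fun θ => by
        rw [polarCoord_symm_apply, Set.indicator_of_mem]
        · rw [smul_eq_mul, circleMap, Complex.exp_mul_I]
          congr 3
          push_cast
          ring
        · have h3 := Real.sin_sq_add_cos_sq θ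
          have h4 : ρ ^ 2 < r ^ 2 := by nlinarith [hρ.1, hρ.2]
          change (ρ * Real.cos θ) ^ 2 + (ρ * Real.sin θ) ^ 2 < r ^ 2
          nlinarith
      simp_rw [h2]
      have hm : Measurable fun θ => ‖F (circleMap 0 ρ θ)‖ₑ :=
        (hFm.comp (continuous_circleMap 0 ρ).measurable).enorm
      rw [lintegral_const_mul _ hm]
      gcongr
      exact enorm_le_lintegral_circleMap hF ρ
    calc ENNReal.ofReal (Real.pi * r ^ 2) * ‖F 0‖ₑ
        = ∫⁻ ρ in Set.Ioo 0 r, ENNReal.ofReal ρ * (ENNReal.ofReal (2 * Real.pi) * ‖F 0‖ₑ) := by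
          rw [lintegral_mul_const _ (by fun_prop)]
          have h5 : ∫⁻ ρ in Set.Ioo 0 r, ENNReal.ofReal ρ = ENNReal.ofReal (r ^ 2 / 2) := by
            rw [← ofReal_integral_eq_lintegral_ofReal]
            · rw [← integral_Ioc_eq_integral_Ioo, ← intervalIntegral.integral_of_le hr.le,
                integral_id]
              simp
            · exact (continuous_id.integrableOn_Icc (a := (0 : ℝ)) (b := r)).mono_set
                Set.Ioo_subset_Icc_self
            · exact (ae_restrict_iff' measurableSet_Ioo).2
                (Filter.Eventually.of_forall fun ρ hρ => hρ.1.le)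
          rw [h5, ← mul_assoc, ← ENNReal.ofReal_mul (by positivity)]
          congr 2
          ring
      _ ≤ _ := setLIntegral_mono' measurableSet_Ioo h1
      _ ≤ _ := lintegral_mono_set Set.Ioo_subset_Ioi_self
  · refine Measurable.aemeasurable ?_
    refine Measurable.smul measurable_fst.ennreal_ofReal ?_
    have hm : Measurable (Set.indicator {p : ℝ × ℝ | p.1 ^ 2 + p.2 ^ 2 < r ^ 2}
        (fun p => ‖F (p.1 + p.2 * Complex.I)‖ₑ)) := Measurable.indicator (by fun_prop) hE
    exact hm.comp continuous_polarCoord_symm.measurable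

/-- The elliptic neighbourhoods of the origin on which the Gaussian short-time Fourier transform is
controlled by its averages. -/
def ellipse (r : ℝ) : Set (ℝ × ℝ) := {w | w.1 ^ 2 + (Real.pi * w.2) ^ 2 < r ^ 2}

theorem measurableSet_ellipse (r : ℝ) : MeasurableSet (ellipse r) :=
  measurableSet_lt (by fun_prop) (by fun_prop)

/-- The map `w ↦ w.1 - iπ w.2` takes the ellipse to the disc of radius `r`; its Jacobian `π` cancels
the `π` in the area of the disc. -/
theorem enorm_le_lintegral_ellipse {F : ℂ → ℂ} (hF : Differentiable ℂ F) {r : ℝ} (hr : 0 < r) :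
    ENNReal.ofReal (r ^ 2) * ‖F 0‖ₑ
      ≤ ∫⁻ w in ellipse r, ‖F (w.1 - Real.pi * w.2 * Complex.I)‖ₑ := by
  have h := enorm_le_lintegral_disc hF hr
  have hFm : Measurable F := hF.continuous.measurable
  have hE : MeasurableSet {p : ℝ × ℝ | p.1 ^ 2 + p.2 ^ 2 < r ^ 2} :=
    measurableSet_lt (by fun_prop) (by fun_prop)
  set f : ℝ × ℝ → ℝ≥0∞ := Set.indicator {p : ℝ × ℝ | p.1 ^ 2 + p.2 ^ 2 < r ^ 2}
    (fun p => ‖F (p.1 + p.2 * Complex.I)‖ₑ) with hf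
  have hfm : Measurable f := Measurable.indicator (by fun_prop) hE
  have h1 : ∫⁻ p, f p = ENNReal.ofReal Real.pi * ∫⁻ p : ℝ × ℝ, f (p.1, -Real.pi * p.2) := by
    rw [Measure.volume_eq_prod, lintegral_prod _ hfm.aemeasurable,
      lintegral_prod _ (by fun_prop), ← lintegral_const_mul _ (by fun_prop)]
    refine lintegral_congr fun x => ?_
    have h2 := Real.smul_map_volume_mul_left (a := -Real.pi) (by simp [Real.pi_ne_zero])
    rw [abs_neg, abs_of_pos Real.pi_pos] at h2
    conv_lhs => rw [← h2]
    rw [lintegral_smul_measure, lintegral_map (by fun_prop) (by fun_prop), smul_eq_mul]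
  have h3 : ∫⁻ p : ℝ × ℝ, f (p.1, -Real.pi * p.2)
      = ∫⁻ w in ellipse r, ‖F (w.1 - Real.pi * w.2 * Complex.I)‖ₑ := by
    rw [← lintegral_indicator (measurableSet_ellipse r)]
    refine lintegral_congr fun p => ?_
    rw [hf]
    have h4 : p ∈ ellipse r ↔
        (p.1, -Real.pi * p.2) ∈ {p : ℝ × ℝ | p.1 ^ 2 + p.2 ^ 2 < r ^ 2} := by
      simp [ellipse]
    by_cases hp : p ∈ ellipse r
    · rw [Set.indicator_of_mem hp, Set.indicator_of_mem (h4.1 hp)]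
      congr 2
      push_cast
      ring
    · rw [Set.indicator_of_notMem hp, Set.indicator_of_notMem (fun h => hp (h4.2 h))]
  rw [← lintegral_indicator hE, ← hf, h1, h3, ENNReal.ofReal_mul Real.pi_pos.le, mul_assoc] at h
  exact (ENNReal.mul_le_mul_iff_right (by simp [Real.pi_pos]) ENNReal.ofReal_ne_top).1 h

theorem differentiable_integral_gaussianWindow (g : L2R) (u : ℝ × ℝ) :
    Differentiable ℂ (fun ζ : ℂ => ∫ t : ℝ, g t * gaussianWindow (t - u.1) *
      Complex.exp (-(2 * Real.pi * Complex.I * u.2 * t)) *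
      Complex.exp (-2 * (t - u.1 : ℝ) * ζ)) := by
  intro ζ₀
  have hg : Measurable g := (Lp.stronglyMeasurable g).measurable
  have hφ : Measurable gaussianWindow := continuous_gaussianWindow.measurable
  set c : ℝ := (2 / Real.pi) ^ (1 / 4 : ℝ) with hc
  have hc0 : 0 ≤ c := by positivity
  set M : ℝ := ‖ζ₀‖ + 1 with hM
  set bound : ℝ → ℝ := fun t => (c * Real.exp (2 * (M + 1) ^ 2)) *
    (‖g t‖ * Real.exp (-(1 / 2) * (t - u.1) ^ 2)) with hbound
  have hbint : Integrable bound := by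
    refine Integrable.const_mul ?_ _
    refine MemLp.integrable_mul (p := 2) (q := 2) (Lp.memLp g).norm ?_
    rw [memLp_two_iff_integrable_sq (by fun_prop)]
    have h := (integrable_exp_neg_mul_sq (b := 1) one_pos).comp_sub_right u.1
    refine h.congr (Filter.Eventually.of_forall fun t => ?_)
    simp only [← Real.exp_nat_mul]
    congr 1
    push_cast
    ring
  -- The factor `exp (2|s|)` leaves room for the factor `2|s|` produced by differentiating in `ζ`.
  -- The constant comes from `2|s|(M + 1) ≤ s² / 2 + 2(M + 1)²`.
  have key : ∀ (s : ℝ) (ζ : ℂ), ‖ζ‖ ≤ M →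
      ‖gaussianWindow s‖ * ‖Complex.exp (-2 * s * ζ)‖ * Real.exp (2 * |s|)
        ≤ c * Real.exp (2 * (M + 1) ^ 2) * Real.exp (-(1 / 2) * s ^ 2) := by
    intro s ζ hζ
    have h1 : ‖gaussianWindow s‖ = c * Real.exp (-s ^ 2) := by
      rw [gaussianWindow, Complex.norm_real, Real.norm_of_nonneg (by positivity)]
    have h2 : ‖Complex.exp (-2 * s * ζ)‖ ≤ Real.exp (2 * |s| * M) := by
      rw [Complex.norm_exp]
      refine Real.exp_le_exp.2 ((Complex.re_le_norm _).trans ?_)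
      rw [norm_mul, norm_mul, Complex.norm_real, Real.norm_eq_abs]
      norm_num
      gcongr
    calc ‖gaussianWindow s‖ * ‖Complex.exp (-2 * s * ζ)‖ * Real.exp (2 * |s|)
        ≤ (c * Real.exp (-s ^ 2)) * Real.exp (2 * |s| * M) * Real.exp (2 * |s|) := by
          rw [h1]; gcongr
      _ = c * Real.exp (-s ^ 2 + 2 * |s| * M + 2 * |s|) := by
          rw [Real.exp_add, Real.exp_add]; ring
      _ ≤ c * Real.exp (2 * (M + 1) ^ 2 + -(1 / 2) * s ^ 2) := by
          refine mul_le_mul_of_nonneg_left (Real.exp_le_exp.2 ?_) hc0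
          nlinarith [sq_nonneg (|s| - 2 * (M + 1)), sq_abs s]
      _ = _ := by rw [Real.exp_add]; ring
  have hexp : ∀ t : ℝ, ‖Complex.exp (-(2 * Real.pi * Complex.I * u.2 * t))‖ = 1 := fun t => by
    rw [Complex.exp_neg, norm_inv, norm_exp_two_pi_I, inv_one]
  refine (hasDerivAt_integral_of_dominated_loc_of_deriv_le (bound := bound)
    (F' := fun ζ t => g t * gaussianWindow (t - u.1) *
      Complex.exp (-(2 * Real.pi * Complex.I * u.2 * t)) *
      (Complex.exp (-2 * (t - u.1 : ℝ) * ζ) * (-2 * (t - u.1 : ℝ))))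
    (Metric.ball_mem_nhds ζ₀ one_pos) (Filter.Eventually.of_forall fun ζ => ?_) ?_ ?_ ?_ hbint
    ?_).2.differentiableAt
  · exact Measurable.aestronglyMeasurable (by fun_prop)
  · refine hbint.mono' (Measurable.aestronglyMeasurable (by fun_prop))
      (Filter.Eventually.of_forall fun t => ?_)
    rw [norm_mul, norm_mul, norm_mul, hexp, mul_one, mul_assoc, hbound]
    have h1 := key (t - u.1) ζ₀ (by simp [hM])
    have h2 : 1 ≤ Real.exp (2 * |t - u.1|) := Real.one_le_exp (by positivity)
    calc _ ≤ ‖g t‖ * (‖gaussianWindow (t - u.1)‖ * ‖Complex.exp (-2 * (t - u.1 : ℝ) * ζ₀)‖ *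
          Real.exp (2 * |t - u.1|)) := by
          refine mul_le_mul_of_nonneg_left ?_ (norm_nonneg _)
          exact le_mul_of_one_le_right (by positivity) h2
      _ ≤ _ := mul_le_mul_of_nonneg_left h1 (norm_nonneg _)
      _ = _ := by ring
  · exact Measurable.aestronglyMeasurable (by fun_prop)
  · refine Filter.Eventually.of_forall fun t ζ hζ => ?_
    rw [norm_mul, norm_mul, norm_mul, norm_mul, hexp, mul_one, mul_assoc, hbound]
    have hζ' : ‖ζ‖ ≤ M := by
      have h3 : ‖ζ‖ ≤ ‖ζ - ζ₀‖ + ‖ζ₀‖ := by simpa using norm_add_le (ζ - ζ₀) ζ₀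
      rw [Metric.mem_ball, dist_eq_norm] at hζ
      linarith
    have h1 := key (t - u.1) ζ hζ'
    have h2 : ‖(-2 * (t - u.1 : ℝ) : ℂ)‖ ≤ Real.exp (2 * |t - u.1|) := by
      rw [norm_mul, Complex.norm_real, Real.norm_eq_abs]
      norm_num
      linarith [Real.add_one_le_exp (2 * |t - u.1|)]
    calc _ ≤ ‖g t‖ * (‖gaussianWindow (t - u.1)‖ * (‖Complex.exp (-2 * (t - u.1 : ℝ) * ζ)‖ *
          Real.exp (2 * |t - u.1|))) := by gcongr
      _ = ‖g t‖ * (‖gaussianWindow (t - u.1)‖ * ‖Complex.exp (-2 * (t - u.1 : ℝ) * ζ)‖ *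
          Real.exp (2 * |t - u.1|)) := by ring
      _ ≤ _ := mul_le_mul_of_nonneg_left h1 (norm_nonneg _)
      _ = _ := by ring
  · refine Filter.Eventually.of_forall fun t ζ _ => ?_
    refine HasDerivAt.const_mul _ ?_
    have h := ((hasDerivAt_id ζ).const_mul (-2 * (t - u.1 : ℝ) : ℂ)).cexp
    simpa using h

/-- Expanding the square in the shifted Gaussian and recentring the modulation at `u.1` puts all
joint dependence on `t` and `w` into `exp (-2(t - u.1)ζ)` with `ζ = w.1 - iπ w.2`. The integral is
therefore an entire function of `ζ`. -/
theorem norm_stft_sub (g : L2R) (u w : ℝ × ℝ) :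
    ‖stft gaussianWindow g (u - w)‖ = Real.exp (-w.1 ^ 2) *
      ‖∫ t : ℝ, g t * gaussianWindow (t - u.1) *
      Complex.exp (-(2 * Real.pi * Complex.I * u.2 * t)) *
      Complex.exp (-2 * (t - u.1 : ℝ) * (w.1 - Real.pi * w.2 * Complex.I))‖ := by
  set c : ℂ := Complex.exp (2 * Real.pi * Complex.I * w.2 * u.1) * Complex.exp (-(w.1 : ℂ) ^ 2)
  have hc : ‖c‖ = Real.exp (-w.1 ^ 2) := by
    rw [norm_mul, norm_exp_two_pi_I, one_mul, Complex.norm_exp, ← Complex.ofReal_pow,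
      ← Complex.ofReal_neg, Complex.ofReal_re]
  rw [stft, ← hc, ← norm_mul, ← integral_const_mul]
  congr 2
  funext t
  rw [conj_gaussianWindow, gaussianWindow_eq, gaussianWindow_eq]
  have h : Complex.exp (-((t - (u - w).1 : ℝ) : ℂ) ^ 2) *
      Complex.exp (-(2 * Real.pi * Complex.I * (u - w).2 * t)) =
      c * (Complex.exp (-((t - u.1 : ℝ) : ℂ) ^ 2) *
        Complex.exp (-(2 * Real.pi * Complex.I * u.2 * t)) *
        Complex.exp (-2 * (t - u.1 : ℝ) * (w.1 - Real.pi * w.2 * Complex.I))) := by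
    simp only [c, ← Complex.exp_add]
    congr 1
    simp only [Prod.fst_sub, Prod.snd_sub]
    push_cast
    ring
  linear_combination (g t * (((2 / Real.pi) ^ (1 / 4 : ℝ) : ℝ) : ℂ)) * h

/-- The mean value inequality is applied to the entire function `F²`; on the ellipse the lost weight
`exp (-2 w.1²)` is at least `exp (-2r²)`. -/
theorem enorm_stft_sq_le (g : L2R) (u : ℝ × ℝ) {r : ℝ} (hr : 0 < r) :
    ENNReal.ofReal (r ^ 2) * ‖stft gaussianWindow g u‖ₑ ^ 2 ≤
      ENNReal.ofReal (Real.exp (2 * r ^ 2)) *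
        ∫⁻ w in ellipse r, ‖stft gaussianWindow g (u - w)‖ₑ ^ 2 := by
  set F : ℂ → ℂ := fun ζ : ℂ => ∫ t : ℝ, g t * gaussianWindow (t - u.1) *
      Complex.exp (-(2 * Real.pi * Complex.I * u.2 * t)) *
      Complex.exp (-2 * (t - u.1 : ℝ) * ζ) with hF
  have hG : ∀ w : ℝ × ℝ, ‖stft gaussianWindow g (u - w)‖ =
    Real.exp (-w.1 ^ 2) * ‖F (w.1 - Real.pi * w.2 * Complex.I)‖ := norm_stft_sub g u
  have h0 : ‖stft gaussianWindow g u‖ = ‖F 0‖ := by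
    have h := hG 0
    simpa using h
  have h1 := enorm_le_lintegral_ellipse
    ((differentiable_integral_gaussianWindow g u).pow 2) hr
  have hm : Measurable fun w : ℝ × ℝ => ‖stft gaussianWindow g (u - w)‖ₑ ^ 2 :=
    (((measurable_stft g).comp (measurable_const.sub measurable_id)).enorm).pow_const 2
  rw [← lintegral_const_mul _ hm, ← ofReal_norm, h0, ofReal_norm, ← enorm_pow]
  refine h1.trans (setLIntegral_mono' (measurableSet_ellipse r) fun w hw => ?_)
  change ‖F (w.1 - Real.pi * w.2 * Complex.I) ^ 2‖ₑ ≤ _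
  rw [← ofReal_norm, norm_pow, ← ofReal_norm, ← ENNReal.ofReal_pow (norm_nonneg _),
    ← ENNReal.ofReal_mul (by positivity), hG w, mul_pow, ← mul_assoc, ← Real.exp_nat_mul,
    ← Real.exp_add]
  refine ENNReal.ofReal_le_ofReal (le_mul_of_one_le_left (by positivity) (Real.one_le_exp ?_))
  have hw' : w.1 ^ 2 + (Real.pi * w.2) ^ 2 < r ^ 2 := hw
  push_cast
  nlinarith [sq_nonneg (Real.pi * w.2)]

/-! ### The trace formula for projections. -/

theorem enorm_starProjection_sq_eq_sum (V : Submodule ℂ L2R) [FiniteDimensional ℂ V] (x : L2R) :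
    ‖V.starProjection x‖ₑ ^ 2 =
      ∑ i, ‖inner ℂ x (stdOrthonormalBasis ℂ V i : L2R)‖ₑ ^ 2 := by
  have h := (stdOrthonormalBasis ℂ V).sum_sq_norm_inner_right
    ⟨V.starProjection x, V.starProjection_apply_mem x⟩
  have h1 : ∀ i, ‖inner ℂ (stdOrthonormalBasis ℂ V i)
      (⟨V.starProjection x, V.starProjection_apply_mem x⟩ : V)‖
      = ‖inner ℂ x (stdOrthonormalBasis ℂ V i : L2R)‖ := fun i => by
    rw [Submodule.coe_inner, ← Submodule.inner_starProjection_left_eq_right,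
      Submodule.starProjection_eq_self_iff.2 (stdOrthonormalBasis ℂ V i).2, norm_inner_symm]
  simp_rw [h1] at h
  change _ = ‖V.starProjection x‖ ^ 2 at h
  rw [← ofReal_norm, ← ENNReal.ofReal_pow (norm_nonneg _), ← h,
    ENNReal.ofReal_sum_of_nonneg fun _ _ => by positivity]
  refine Finset.sum_congr rfl fun i _ => ?_
  rw [ENNReal.ofReal_pow (norm_nonneg _), ofReal_norm]

theorem measurable_enorm_starProjection_gaussianAtom (V : Submodule ℂ L2R)
    [FiniteDimensional ℂ V] :
    Measurable fun z => ‖V.starProjection (gaussianAtom z)‖ₑ ^ 2 := by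
  simp_rw [enorm_starProjection_sq_eq_sum, inner_gaussianAtom]
  exact Finset.measurable_sum _ fun i _ => (measurable_stft _).enorm.pow_const 2

/-- Each vector of an orthonormal basis of `V` contributes the squared norm of its transform, which
is `1`. -/
theorem lintegral_enorm_starProjection_gaussianAtom (V : Submodule ℂ L2R)
    [FiniteDimensional ℂ V] :
    ∫⁻ z, ‖V.starProjection (gaussianAtom z)‖ₑ ^ 2 = Module.finrank ℂ V := by
  simp_rw [enorm_starProjection_sq_eq_sum, inner_gaussianAtom]
  rw [lintegral_finsetSum _ fun i _ => (measurable_stft _).enorm.pow_const 2]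
  simp_rw [lintegral_enorm_stft_sq]
  have h : ∀ i, ‖(stdOrthonormalBasis ℂ V i : L2R)‖ₑ ^ 2 = 1 := fun i => by
    have h1 := (stdOrthonormalBasis ℂ V).norm_eq_one i
    rw [Submodule.coe_norm] at h1
    rw [← ofReal_norm, h1, ENNReal.ofReal_one, one_pow]
  simp [h]

/-! ### Squares and the cross integral. -/

theorem cube_eq_prod (c : ℝ × ℝ) (R : ℝ) :
    cube c R = Set.Icc (c.1 - R) (c.1 + R) ×ˢ Set.Icc (c.2 - R) (c.2 + R) := by
  ext p
  simp only [cube, Set.mem_ofPred_eq, Set.mem_prod, Set.mem_Icc, abs_le]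
  constructor <;> rintro ⟨⟨_, _⟩, _, _⟩ <;> refine ⟨⟨?_, ?_⟩, ?_, ?_⟩ <;> linarith

theorem measurableSet_cube (c : ℝ × ℝ) (R : ℝ) : MeasurableSet (cube c R) := by
  rw [cube_eq_prod]
  exact measurableSet_Icc.prod measurableSet_Icc

theorem volume_cube (c : ℝ × ℝ) {R : ℝ} (hR : 0 ≤ R) :
    volume (cube c R) = ENNReal.ofReal ((2 * R) ^ 2) := by
  rw [cube_eq_prod, Measure.volume_eq_prod, Measure.prod_prod, Real.volume_Icc, Real.volume_Icc,
    ← ENNReal.ofReal_mul (by linarith)]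
  congr 1
  ring

/-- The nonnegative extended real version of `crossIntegral`, over squares with centre `c`. -/
noncomputable def crossLIntegral (G : ℝ × ℝ → ℂ) (c : ℝ × ℝ) (R R' : ℝ) : ℝ≥0∞ :=
  ∫⁻ p in cube c R, ∫⁻ q in (cube c R')ᶜ, ‖G (q - p)‖ₑ ^ 2

theorem crossLIntegral_eq_zero_centre (G : ℝ × ℝ → ℂ) (c : ℝ × ℝ) (R R' : ℝ) :
    crossLIntegral G c R R' = crossLIntegral G 0 R R' := by
  have hmem : ∀ (S : ℝ) (p : ℝ × ℝ), p + c ∈ cube c S ↔ p ∈ cube 0 S := fun S p => by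
    simp [cube]
  have h1 : ∀ (S : Set (ℝ × ℝ)) (S₀ : Set (ℝ × ℝ)) (_ : MeasurableSet S) (_ : MeasurableSet S₀)
      (_ : ∀ p, p + c ∈ S ↔ p ∈ S₀) (f : ℝ × ℝ → ℝ≥0∞),
      ∫⁻ p in S, f p = ∫⁻ p in S₀, f (p + c) := fun S S₀ hS hS₀ h f => by
    rw [← lintegral_indicator hS, ← lintegral_indicator hS₀,
      ← lintegral_add_right_eq_self _ c]
    refine lintegral_congr fun p => ?_
    by_cases hp : p ∈ S₀
    · rw [Set.indicator_of_mem hp, Set.indicator_of_mem ((h p).2 hp)]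
    · rw [Set.indicator_of_notMem hp, Set.indicator_of_notMem fun h' => hp ((h p).1 h')]
  rw [crossLIntegral, h1 _ _ (measurableSet_cube c R) (measurableSet_cube 0 R) (hmem R)]
  refine lintegral_congr fun p => ?_
  rw [h1 _ _ (measurableSet_cube c R').compl (measurableSet_cube 0 R').compl
    (fun p => not_congr (hmem R' p))]
  simp only [add_sub_add_right_eq_sub]

/-- The substitution `p ↦ c - p` in both variables reverses their difference. The frame case needs
this, since there the points of `Λ` lie outside the square. -/
theorem crossLIntegral_reflect (G : ℝ × ℝ → ℂ) (c : ℝ × ℝ) (R R' : ℝ) :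
    ∫⁻ p in cube c R, ∫⁻ q in (cube c R')ᶜ, ‖G (p - q)‖ₑ ^ 2 = crossLIntegral G 0 R R' := by
  have hmem : ∀ (S : ℝ) (p : ℝ × ℝ), c - p ∈ cube c S ↔ p ∈ cube 0 S := fun S p => by
    simp [cube]
  have h1 : ∀ (S : Set (ℝ × ℝ)) (S₀ : Set (ℝ × ℝ)) (_ : MeasurableSet S) (_ : MeasurableSet S₀)
      (_ : ∀ p, c - p ∈ S ↔ p ∈ S₀) (f : ℝ × ℝ → ℝ≥0∞),
      ∫⁻ p in S, f p = ∫⁻ p in S₀, f (c - p) := fun S S₀ hS hS₀ h f => by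
    rw [← lintegral_indicator hS, ← lintegral_indicator hS₀,
      ← lintegral_sub_left_eq_self _ c]
    refine lintegral_congr fun p => ?_
    by_cases hp : p ∈ S₀
    · rw [Set.indicator_of_mem hp, Set.indicator_of_mem ((h p).2 hp)]
    · rw [Set.indicator_of_notMem hp, Set.indicator_of_notMem fun h' => hp ((h p).1 h')]
  rw [crossLIntegral, h1 _ _ (measurableSet_cube c R) (measurableSet_cube 0 R) (hmem R)]
  refine lintegral_congr fun p => ?_
  rw [h1 _ _ (measurableSet_cube c R').compl (measurableSet_cube 0 R').compl
    (fun p => not_congr (hmem R' p))]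
  simp only [sub_sub_sub_cancel_left]

theorem measurable_enorm_stft_sub_sq (g : L2R) :
    Measurable fun q : (ℝ × ℝ) × (ℝ × ℝ) => ‖stft gaussianWindow g (q.2 - q.1)‖ₑ ^ 2 :=
  ((measurable_stft g).comp (measurable_snd.sub measurable_fst)).enorm.pow_const 2

theorem lintegral_stft_sub_le (g : L2R) (p : ℝ × ℝ) (S : Set (ℝ × ℝ)) :
    ∫⁻ q in S, ‖stft gaussianWindow g (q - p)‖ₑ ^ 2 ≤ ‖g‖ₑ ^ 2 := by
  refine (setLIntegral_le_lintegral _ _).trans ?_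
  rw [lintegral_sub_right_eq_self (fun q => ‖stft gaussianWindow g q‖ₑ ^ 2) p,
    lintegral_enorm_stft_sq]

/-- The inner integral is at most `‖g‖²` and the square has finite area, so the Bochner integrals do
not take their default value `0`. -/
theorem ofReal_crossIntegral (g : L2R) {R : ℝ} (hR : 0 ≤ R) :
    ENNReal.ofReal (crossIntegral (stft gaussianWindow g) R)
      = crossLIntegral (stft gaussianWindow g) 0 R (R + 1 / 4) := by
  set f : ℝ × ℝ → ℝ≥0∞ := fun p =>
    ∫⁻ q in (cube 0 (R + 1 / 4))ᶜ, ‖stft gaussianWindow g (q - p)‖ₑ ^ 2 with hf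
  have htop : ‖g‖ₑ ^ 2 < ∞ := ENNReal.pow_lt_top enorm_lt_top
  have hfle : ∀ p, f p ≤ ‖g‖ₑ ^ 2 := fun p => lintegral_stft_sub_le g p _
  have hfm : Measurable f := (measurable_enorm_stft_sub_sq g).lintegral_prod_right'
  have h1 : ∀ p, ∫ q in (cube 0 (R + 1 / 4))ᶜ, ‖stft gaussianWindow g (q - p)‖ ^ 2
      = (f p).toReal := fun p => by
    have hm : Measurable fun q : ℝ × ℝ => ‖stft gaussianWindow g (q - p)‖ ^ 2 :=
      ((measurable_stft g).comp (measurable_id.sub measurable_const)).norm.pow_const 2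
    rw [integral_eq_lintegral_of_nonneg_ae (Filter.Eventually.of_forall fun q => by positivity)
      hm.aestronglyMeasurable]
    congr 1
    refine lintegral_congr fun q => ?_
    rw [ENNReal.ofReal_pow (norm_nonneg _), ofReal_norm]
  have hfin : ∫⁻ p in cube 0 R, f p ≠ ∞ := by
    refine ne_top_of_le_ne_top ?_ (setLIntegral_mono measurable_const fun p _ => hfle p)
    rw [setLIntegral_const, volume_cube 0 hR]
    exact ENNReal.mul_ne_top htop.ne ENNReal.ofReal_ne_top
  rw [crossIntegral]
  simp_rw [h1]
  rw [integral_toReal hfm.aemeasurable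
    (Filter.Eventually.of_forall fun p => (hfle p).trans_lt htop), ENNReal.ofReal_toReal hfin]
  rfl

/-! ### From sums over separated points to integrals. -/

theorem sum_lintegral_stft_sub_le (g : L2R) {ι : Type*} [Countable ι] (x : ι → ℝ × ℝ) {r : ℝ}
    (hr : 0 < r) (U D : Set (ℝ × ℝ))
    (hdisj : Pairwise fun i j => Disjoint {w | w - x i ∈ ellipse r} {w | w - x j ∈ ellipse r})
    (hD : ∀ i w, w - x i ∈ ellipse r → w ∈ D) :
    ENNReal.ofReal (r ^ 2) * ∑' i, ∫⁻ z in U, ‖stft gaussianWindow g (z - x i)‖ₑ ^ 2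
      ≤ ENNReal.ofReal (Real.exp (2 * r ^ 2)) *
        ∫⁻ w in D, ∫⁻ z in U, ‖stft gaussianWindow g (z - w)‖ₑ ^ 2 := by
  have hG := measurable_stft g
  have hms : ∀ i, MeasurableSet {w | w - x i ∈ ellipse r} := fun i =>
    (measurable_id.sub measurable_const) (measurableSet_ellipse r)
  set Φ : ℝ × ℝ → ℝ≥0∞ := fun w => ∫⁻ z in U, ‖stft gaussianWindow g (z - w)‖ₑ ^ 2 with hΦ
  have h1 : ∀ i, ENNReal.ofReal (r ^ 2) * ∫⁻ z in U, ‖stft gaussianWindow g (z - x i)‖ₑ ^ 2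
      ≤ ENNReal.ofReal (Real.exp (2 * r ^ 2)) * ∫⁻ w in {w | w - x i ∈ ellipse r}, Φ w := by
    intro i
    have hm2 : Measurable fun q : (ℝ × ℝ) × (ℝ × ℝ) =>
        ‖stft gaussianWindow g (q.1 - x i - q.2)‖ₑ ^ 2 :=
      (hG.comp ((measurable_fst.sub measurable_const).sub measurable_snd)).enorm.pow_const 2
    calc ENNReal.ofReal (r ^ 2) * ∫⁻ z in U, ‖stft gaussianWindow g (z - x i)‖ₑ ^ 2
        = ∫⁻ z in U, ENNReal.ofReal (r ^ 2) * ‖stft gaussianWindow g (z - x i)‖ₑ ^ 2 :=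
          (lintegral_const_mul _ ((hG.comp
            (measurable_id.sub measurable_const)).enorm.pow_const 2)).symm
      _ ≤ ∫⁻ z in U, ENNReal.ofReal (Real.exp (2 * r ^ 2)) *
          ∫⁻ w in ellipse r, ‖stft gaussianWindow g (z - x i - w)‖ₑ ^ 2 :=
          lintegral_mono fun z => enorm_stft_sq_le g (z - x i) hr
      _ = ENNReal.ofReal (Real.exp (2 * r ^ 2)) *
          ∫⁻ z in U, ∫⁻ w in ellipse r, ‖stft gaussianWindow g (z - x i - w)‖ₑ ^ 2 :=
          lintegral_const_mul _ hm2.lintegral_prod_right'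
      _ = ENNReal.ofReal (Real.exp (2 * r ^ 2)) * ∫⁻ w in ellipse r, Φ (w + x i) := by
          rw [lintegral_lintegral_swap hm2.aemeasurable]
          simp_rw [hΦ, sub_sub, add_comm (x i)]
      _ = _ := by
          rw [← lintegral_indicator (measurableSet_ellipse r), ← lintegral_indicator (hms i),
            ← lintegral_add_right_eq_self (Set.indicator {w | w - x i ∈ ellipse r} Φ) (x i)]
          congr 2
          ext w
          by_cases hw : w ∈ ellipse r
          · rw [Set.indicator_of_mem hw, Set.indicator_of_mem (by simpa using hw)]
          · rw [Set.indicator_of_notMem hw, Set.indicator_of_notMem (by simpa using hw)]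
  calc ENNReal.ofReal (r ^ 2) * ∑' i, ∫⁻ z in U, ‖stft gaussianWindow g (z - x i)‖ₑ ^ 2
      = ∑' i, ENNReal.ofReal (r ^ 2) * ∫⁻ z in U, ‖stft gaussianWindow g (z - x i)‖ₑ ^ 2 :=
        ENNReal.tsum_mul_left.symm
    _ ≤ ∑' i, ENNReal.ofReal (Real.exp (2 * r ^ 2)) *
          ∫⁻ w in {w | w - x i ∈ ellipse r}, Φ w := ENNReal.tsum_le_tsum h1
    _ = ENNReal.ofReal (Real.exp (2 * r ^ 2)) *
          ∫⁻ w in ⋃ i, {w | w - x i ∈ ellipse r}, Φ w := by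
        rw [ENNReal.tsum_mul_left, lintegral_iUnion hms hdisj]
    _ ≤ _ := by
        gcongr
        exact Set.iUnion_subset fun i w hw => hD i w hw

theorem abs_le_of_mem_ellipse {r : ℝ} (hr : 0 < r) {w : ℝ × ℝ} (hw : w ∈ ellipse r) :
    |w.1| ≤ r ∧ |w.2| ≤ r := by
  have h : w.1 ^ 2 + (Real.pi * w.2) ^ 2 < r ^ 2 := hw
  have hπ : 1 ≤ Real.pi ^ 2 := by nlinarith [Real.pi_gt_three]
  rw [mul_pow] at h
  constructor
  · exact abs_le_of_sq_le_sq (by nlinarith [sq_nonneg w.2]) hr.le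
  · exact abs_le_of_sq_le_sq (by nlinarith [sq_nonneg w.2, sq_nonneg w.1]) hr.le

theorem sq_add_sq_lt_of_mem_ellipse {r : ℝ} {w : ℝ × ℝ} (hw : w ∈ ellipse r) :
    w.1 ^ 2 + w.2 ^ 2 < r ^ 2 := by
  have h : w.1 ^ 2 + (Real.pi * w.2) ^ 2 < r ^ 2 := hw
  have hπ : 1 ≤ Real.pi ^ 2 := by nlinarith [Real.pi_gt_three]
  rw [mul_pow] at h
  nlinarith [sq_nonneg w.2]

theorem HasSeparation.disjoint_ellipse {Λ : Set (ℝ × ℝ)} {δ r : ℝ} (hΛ : HasSeparation Λ δ)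
    (hδ : 0 < δ) (hr : r ≤ δ / 2) (hr0 : 0 < r) (p q : Λ) (hpq : p ≠ q) :
    Disjoint {w | w - (p : ℝ × ℝ) ∈ ellipse r} {w | w - (q : ℝ × ℝ) ∈ ellipse r} := by
  refine Set.disjoint_left.2 fun w hp hq => ?_
  have h := hΛ p p.2 q q.2 fun h => hpq (Subtype.ext h)
  have h1 := sq_add_sq_lt_of_mem_ellipse hp
  have h2 := sq_add_sq_lt_of_mem_ellipse hq
  simp only [Prod.fst_sub, Prod.snd_sub] at h1 h2
  rw [Real.lt_sqrt hδ.le] at h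
  nlinarith [sq_nonneg ((w.1 - (p : ℝ × ℝ).1) + (w.1 - (q : ℝ × ℝ).1)),
    sq_nonneg ((w.2 - (p : ℝ × ℝ).2) + (w.2 - (q : ℝ × ℝ).2))]

/-- The index of the cell of side length `δ / 2` that contains a point of the plane. -/
noncomputable def gridCell (δ : ℝ) (p : ℝ × ℝ) : ℤ × ℤ := (⌊p.1 / (δ / 2)⌋, ⌊p.2 / (δ / 2)⌋)

theorem HasSeparation.injOn_gridCell {Λ : Set (ℝ × ℝ)} {δ : ℝ} (hΛ : HasSeparation Λ δ)
    (hδ : 0 < δ) : Set.InjOn (gridCell δ) Λ := by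
  intro p hp q hq h
  by_contra hne
  have h0 := hΛ p hp q hq hne
  rw [Real.lt_sqrt hδ.le] at h0
  -- A cell has diagonal `δ / √2 < δ`, so it cannot contain two points of `Λ`.
  have key : ∀ a b : ℝ, ⌊a / (δ / 2)⌋ = ⌊b / (δ / 2)⌋ → (a - b) ^ 2 ≤ δ ^ 2 / 4 := by
    intro a b hab
    have h1 := Int.abs_sub_lt_one_of_floor_eq_floor hab
    rw [← sub_div, abs_div, abs_of_pos (half_pos hδ), div_lt_one (half_pos hδ)] at h1
    nlinarith [sq_abs (a - b), abs_nonneg (a - b)]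
  have h1 := key _ _ (congrArg Prod.fst h)
  have h2 := key _ _ (congrArg Prod.snd h)
  nlinarith

theorem HasSeparation.countable {Λ : Set (ℝ × ℝ)} {δ : ℝ} (hΛ : HasSeparation Λ δ)
    (hδ : 0 < δ) : Countable Λ :=
  Function.Injective.countable (f := fun p : Λ => gridCell δ p)
    (Set.injOn_iff_injective.1 (hΛ.injOn_gridCell hδ))

theorem HasSeparation.finite_inter_cube {Λ : Set (ℝ × ℝ)} {δ : ℝ} (hΛ : HasSeparation Λ δ)
    (hδ : 0 < δ) (c : ℝ × ℝ) (R : ℝ) : (Λ ∩ cube c R).Finite := by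
  refine Set.Finite.of_injOn (t := Set.Icc ⌊(c.1 - R) / (δ / 2)⌋ ⌊(c.1 + R) / (δ / 2)⌋ ×ˢ
    Set.Icc ⌊(c.2 - R) / (δ / 2)⌋ ⌊(c.2 + R) / (δ / 2)⌋) (fun p hp => ?_)
    ((hΛ.injOn_gridCell hδ).mono Set.inter_subset_left)
    ((Set.finite_Icc _ _).prod (Set.finite_Icc _ _))
  have h := hp.2
  rw [cube_eq_prod] at h
  obtain ⟨⟨h1, h2⟩, h3, h4⟩ := h
  refine ⟨⟨?_, ?_⟩, ?_, ?_⟩ <;> exact Int.floor_le_floor (by gcongr)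

/-! ### Dimension against area, and the two counting bounds. -/

theorem finrank_le_of_norm_starProjection_sq_le {V : Submodule ℂ L2R} [FiniteDimensional ℂ V]
    {A : ℝ} (hA : 0 < A) {g : L2R} {Λ : Set (ℝ × ℝ)} (s : Finset Λ)
    (hV : ∀ x, A * ‖V.starProjection x‖ ^ 2 ≤ ∑ p ∈ s, ‖inner ℂ (gaborSystem g Λ p) x‖ ^ 2)
    {Q : Set (ℝ × ℝ)} (hQ : MeasurableSet Q) :
    (Module.finrank ℂ V : ℝ≥0∞) ≤ volume Q + ENNReal.ofReal A⁻¹ *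
      ∑ p ∈ s, ∫⁻ z in Qᶜ, ‖stft gaussianWindow g (z - p)‖ₑ ^ 2 := by
  have hm : ∀ p : ℝ × ℝ, Measurable fun z => ‖stft gaussianWindow g (z - p)‖ₑ ^ 2 := fun p =>
    ((measurable_stft g).comp (measurable_id.sub measurable_const)).enorm.pow_const 2
  rw [← lintegral_enorm_starProjection_gaussianAtom V, ← lintegral_add_compl _ hQ]
  gcongr
  · calc ∫⁻ z in Q, ‖V.starProjection (gaussianAtom z)‖ₑ ^ 2 ≤ ∫⁻ z in Q, 1 := by
          refine lintegral_mono fun z => ?_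
          rw [← enorm_gaussianAtom_sq z]
          gcongr
          rw [← ofReal_norm, ← ofReal_norm]
          exact ENNReal.ofReal_le_ofReal (V.norm_starProjection_apply_le _)
      _ = volume Q := by simp
  · rw [← lintegral_finsetSum s fun (p : Λ) _ => hm p,
      ← lintegral_const_mul _ (Finset.measurable_sum s fun (p : Λ) _ => hm p)]
    refine lintegral_mono fun z => ?_
    have h := hV (gaussianAtom z)
    have h1 : ‖V.starProjection (gaussianAtom z)‖ ^ 2
        ≤ A⁻¹ * ∑ p ∈ s, ‖stft gaussianWindow g (z - p)‖ ^ 2 := by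
      rw [le_inv_mul_iff₀ hA]
      simpa only [gaborSystem, norm_inner_timeFreqShift_gaussianAtom] using h
    have h2 := ENNReal.ofReal_le_ofReal h1
    rw [ENNReal.ofReal_mul (by positivity),
      ENNReal.ofReal_sum_of_nonneg fun _ _ => by positivity] at h2
    simpa only [ENNReal.ofReal_pow (norm_nonneg _), ofReal_norm] using h2

theorem volume_le_of_norm_sub_starProjection_sq_le {V : Submodule ℂ L2R}
    [FiniteDimensional ℂ V] {A B : ℝ} (hA : 0 < A) {g : L2R} {Λ : Set (ℝ × ℝ)} [Countable Λ]
    (hf : IsFrame (gaborSystem g Λ) A B) (s : Finset Λ)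
    (hV : ∀ x, A * ‖x - V.starProjection x‖ ^ 2 ≤
      ∑' p : {p // p ∉ s}, ‖inner ℂ (gaborSystem g Λ p) x‖ ^ 2) (Q : Set (ℝ × ℝ)) :
    volume Q ≤ Module.finrank ℂ V + ENNReal.ofReal A⁻¹ *
      ∑' p : {p // p ∉ s}, ∫⁻ z in Q, ‖stft gaussianWindow g (z - (p : Λ))‖ₑ ^ 2 := by
  have hm : ∀ p : ℝ × ℝ, Measurable fun z => ‖stft gaussianWindow g (z - p)‖ₑ ^ 2 := fun p =>
    ((measurable_stft g).comp (measurable_id.sub measurable_const)).enorm.pow_const 2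
  have key : ∀ z, 1 ≤ ‖V.starProjection (gaussianAtom z)‖ₑ ^ 2 + ENNReal.ofReal A⁻¹ *
      ∑' p : {p // p ∉ s}, ‖stft gaussianWindow g (z - (p : Λ))‖ₑ ^ 2 := fun z => by
    have h := hV (gaussianAtom z)
    simp only [gaborSystem, norm_inner_timeFreqShift_gaussianAtom] at h
    have hs : Summable fun p : {p // p ∉ s} =>
        ‖stft gaussianWindow g (z - ((p : Λ) : ℝ × ℝ))‖ ^ 2 := by
      have h0 := (hf (gaussianAtom z)).1.subtype {p | p ∉ s}
      simp only [gaborSystem, Function.comp_def, norm_inner_timeFreqShift_gaussianAtom] at h0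
      exact h0
    have h1 : ‖gaussianAtom z‖ ^ 2 ≤ ‖V.starProjection (gaussianAtom z)‖ ^ 2 +
        A⁻¹ * ∑' p : {p // p ∉ s}, ‖stft gaussianWindow g (z - (p : Λ))‖ ^ 2 := by
      have h2 : ‖gaussianAtom z‖ ^ 2 = ‖V.starProjection (gaussianAtom z)‖ ^ 2 +
          ‖gaussianAtom z - V.starProjection (gaussianAtom z)‖ ^ 2 := by
        have h3 := V.norm_sq_eq_add_norm_sq_starProjection (gaussianAtom z)
        rwa [Submodule.starProjection_orthogonal_val] at h3
      rw [h2]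
      gcongr
      rwa [le_inv_mul_iff₀ hA]
    have h4 := ENNReal.ofReal_le_ofReal h1
    rw [ENNReal.ofReal_add (by positivity) (by positivity), ENNReal.ofReal_mul (by positivity),
      ENNReal.ofReal_tsum_of_nonneg (fun _ => by positivity) hs] at h4
    simp only [ENNReal.ofReal_pow (norm_nonneg _), ofReal_norm] at h4
    rwa [enorm_gaussianAtom_sq] at h4
  calc volume Q = ∫⁻ z in Q, 1 := by simp
    _ ≤ ∫⁻ z in Q, (‖V.starProjection (gaussianAtom z)‖ₑ ^ 2 + ENNReal.ofReal A⁻¹ *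
      ∑' p : {p // p ∉ s}, ‖stft gaussianWindow g (z - (p : Λ))‖ₑ ^ 2) := lintegral_mono key
    _ = (∫⁻ z in Q, ‖V.starProjection (gaussianAtom z)‖ₑ ^ 2) + ENNReal.ofReal A⁻¹ *
      ∑' p : {p // p ∉ s}, ∫⁻ z in Q, ‖stft gaussianWindow g (z - (p : Λ))‖ₑ ^ 2 := by
        rw [lintegral_add_left (measurable_enorm_starProjection_gaussianAtom V),
          lintegral_const_mul _ (Measurable.tsum fun p => hm _),
          lintegral_tsum fun p => (hm _).aemeasurable]
    _ ≤ _ := by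
        gcongr
        rw [← lintegral_enorm_starProjection_gaussianAtom V]
        exact setLIntegral_le_lintegral _ _

theorem le_const_mul_of_mul_le {A r E : ℝ} {X Y : ℝ≥0∞} (hr : 0 < r) (hA : 0 < A)
    (h : ENNReal.ofReal (r ^ 2) * X ≤ ENNReal.ofReal E * Y) :
    ENNReal.ofReal A⁻¹ * X ≤ ENNReal.ofReal (E / (A * r ^ 2)) * Y := by
  have h1 : ENNReal.ofReal A⁻¹ * X
      = ENNReal.ofReal (A * r ^ 2)⁻¹ * (ENNReal.ofReal (r ^ 2) * X) := by
    rw [← mul_assoc, ← ENNReal.ofReal_mul (by positivity)]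
    congr 2
    field_simp
  rw [h1, div_eq_inv_mul, ENNReal.ofReal_mul (by positivity), mul_assoc]
  gcongr

theorem ncard_inter_cube {Λ : Set (ℝ × ℝ)} {c : ℝ × ℝ} {R : ℝ}
    (s : Finset Λ) (hs : ∀ p : Λ, p ∈ s ↔ (p : ℝ × ℝ) ∈ cube c R) :
    (Λ ∩ cube c R).ncard = s.card := by
  have h : Λ ∩ cube c R = Subtype.val '' (s : Set Λ) := by
    ext p
    constructor
    · rintro ⟨hp, hc⟩
      exact ⟨⟨p, hp⟩, (hs _).2 hc, rfl⟩
    · rintro ⟨q, hq, rfl⟩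
      exact ⟨q.2, (hs q).1 hq⟩
  rw [h, Set.ncard_image_of_injective _ Subtype.val_injective, Set.ncard_coe_finset]

theorem crossIntegral_nonneg (G : ℝ × ℝ → ℂ) (R : ℝ) : 0 ≤ crossIntegral G R :=
  integral_nonneg fun p => integral_nonneg fun q => by positivity

theorem ncard_le_of_isRieszSequence {δ A B r : ℝ} (hδ : 0 < δ) (hA : 0 < A) (hr : 0 < r)
    (hrδ : r ≤ δ / 2) (hr4 : r ≤ 1 / 4) {g : L2R} {Λ : Set (ℝ × ℝ)} (hΛ : HasSeparation Λ δ)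
    (hf : IsRieszSequence (gaborSystem g Λ) A B) {R : ℝ} (hR : 0 < R) (c : ℝ × ℝ)
    (s : Finset Λ) (hs : ∀ p : Λ, p ∈ s ↔ (p : ℝ × ℝ) ∈ cube c R) :
    (s.card : ℝ) ≤ (2 * R + 1) ^ 2 + Real.exp (2 * r ^ 2) / (A * r ^ 2) *
      crossIntegral (stft gaussianWindow g) (R + 1 / 4) := by
  have hfd : FiniteDimensional ℂ
      (Submodule.span ℂ (Set.range fun p : s => gaborSystem g Λ p)) :=
    FiniteDimensional.span_of_finite ℂ (Set.finite_range _)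
  have h1 := finrank_le_of_norm_starProjection_sq_le hA s (hf.norm_starProjection_sq_le s)
    (measurableSet_cube c (R + 1 / 2))
  rw [hf.finrank_span hA, volume_cube c (by linarith)] at h1
  -- The margin `1/2` is spent in two halves: `r ≤ 1/4` keeps the ellipses inside radius `R + 1/4`,
  -- and the other `1/4` is the gap built into `crossIntegral`.
  have h2 := sum_lintegral_stft_sub_le g (fun p : s => ((p : Λ) : ℝ × ℝ)) hr
    (cube c (R + 1 / 2))ᶜ (cube c (R + 1 / 4))
    (fun p q hpq => hΛ.disjoint_ellipse hδ hrδ hr p q fun h => hpq (Subtype.ext h))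
    (fun p w hw => by
      obtain ⟨hw1, hw2⟩ := abs_le_of_mem_ellipse hr hw
      obtain ⟨hp1, hp2⟩ := (hs p).1 p.2
      simp only [Prod.fst_sub, Prod.snd_sub] at hw1 hw2
      exact ⟨(abs_sub_le _ (p : ℝ × ℝ).1 _).trans (by linarith),
        (abs_sub_le _ (p : ℝ × ℝ).2 _).trans (by linarith)⟩)
  rw [tsum_fintype, Finset.sum_coe_sort s
    (fun p => ∫⁻ z in (cube c (R + 1 / 2))ᶜ, ‖stft gaussianWindow g (z - p)‖ₑ ^ 2)] at h2
  have h3 := le_const_mul_of_mul_le hr hA h2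
  have h4 : ∫⁻ w in cube c (R + 1 / 4), ∫⁻ z in (cube c (R + 1 / 2))ᶜ,
      ‖stft gaussianWindow g (z - w)‖ₑ ^ 2
      = ENNReal.ofReal (crossIntegral (stft gaussianWindow g) (R + 1 / 4)) := by
    rw [ofReal_crossIntegral g (by linarith), ← crossLIntegral_eq_zero_centre _ c,
      show R + 1 / 4 + 1 / 4 = R + 1 / 2 by ring]
    rfl
  have h0 := crossIntegral_nonneg (stft gaussianWindow g) (R + 1 / 4)
  rw [h4, ← ENNReal.ofReal_mul (by positivity)] at h3
  have h5 := h1.trans (add_le_add_right h3 _)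
  rw [← ENNReal.ofReal_add (by positivity) (by positivity), ← ENNReal.ofReal_natCast,
    ENNReal.ofReal_le_ofReal_iff (by positivity)] at h5
  rwa [show 2 * (R + 1 / 2) = 2 * R + 1 by ring] at h5

theorem le_ncard_of_isFrame {δ A B r : ℝ} (hδ : 0 < δ) (hA : 0 < A) (hr : 0 < r)
    (hrδ : r ≤ δ / 2) (hr4 : r ≤ 1 / 4) {g : L2R} {Λ : Set (ℝ × ℝ)} (hΛ : HasSeparation Λ δ)
    (hf : IsFrame (gaborSystem g Λ) A B) {R : ℝ} (hR : 1 / 2 ≤ R) (c : ℝ × ℝ)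
    (s : Finset Λ) (hs : ∀ p : Λ, p ∈ s ↔ (p : ℝ × ℝ) ∈ cube c R) :
    (2 * R - 1) ^ 2 - Real.exp (2 * r ^ 2) / (A * r ^ 2) *
      crossIntegral (stft gaussianWindow g) (R - 1 / 2) ≤ (s.card : ℝ) := by
  have := hΛ.countable hδ
  obtain ⟨V, hVfd, hVs, hV⟩ := hf.exists_submodule hA s
  have h1 := volume_le_of_norm_sub_starProjection_sq_le hA hf s hV (cube c (R - 1 / 2))
  rw [volume_cube c (by linarith)] at h1
  -- Here the ellipses around points outside radius `R` stay outside radius `R - 1/4`.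
  have h2 := sum_lintegral_stft_sub_le g (fun p : {p // p ∉ s} => ((p : Λ) : ℝ × ℝ)) hr
    (cube c (R - 1 / 2)) (cube c (R - 1 / 4))ᶜ
    (fun p q hpq => hΛ.disjoint_ellipse hδ hrδ hr p q fun h => hpq (Subtype.ext h))
    (fun p w hw hwc => by
      obtain ⟨hw1, hw2⟩ := abs_le_of_mem_ellipse hr hw
      obtain ⟨hc1, hc2⟩ := hwc
      simp only [Prod.fst_sub, Prod.snd_sub] at hw1 hw2
      rw [abs_sub_comm] at hw1 hw2
      exact p.2 ((hs p).2 ⟨(abs_sub_le _ w.1 _).trans (by linarith),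
        (abs_sub_le _ w.2 _).trans (by linarith)⟩))
  have h3 := le_const_mul_of_mul_le hr hA h2
  have h4 : ∫⁻ w in (cube c (R - 1 / 4))ᶜ, ∫⁻ z in cube c (R - 1 / 2),
      ‖stft gaussianWindow g (z - w)‖ₑ ^ 2
      = ENNReal.ofReal (crossIntegral (stft gaussianWindow g) (R - 1 / 2)) := by
    rw [lintegral_lintegral_swap (measurable_enorm_stft_sub_sq g).aemeasurable,
      crossLIntegral_reflect, ofReal_crossIntegral g (by linarith),
      show R - 1 / 2 + 1 / 4 = R - 1 / 4 by ring]
  have h0 := crossIntegral_nonneg (stft gaussianWindow g) (R - 1 / 2)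
  rw [h4, ← ENNReal.ofReal_mul (by positivity)] at h3
  have h5 := h1.trans (add_le_add (Nat.cast_le.2 hVs) h3)
  rw [← ENNReal.ofReal_natCast, ← ENNReal.ofReal_add (by positivity) (by positivity),
    ENNReal.ofReal_le_ofReal_iff (by positivity)] at h5
  rw [show 2 * (R - 1 / 2) = 2 * R - 1 by ring] at h5
  linarith

end GaborDensity

theorem theorem4 (δ A B : ℝ) (hδ : 0 < δ) (hA : 0 < A) (hB : 0 < B) :
    ∃ C : ℝ, 0 < C ∧
      ∀ (g : GaborDensity.L2R) (Λ : Set (ℝ × ℝ)), GaborDensity.HasSeparation Λ δ →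
        (GaborDensity.IsRieszSequence (GaborDensity.gaborSystem g Λ) A B →
          ∀ R : ℝ, 0 < R → ∀ c : ℝ × ℝ,
            (Λ ∩ GaborDensity.cube c R).Finite ∧
            ((Λ ∩ GaborDensity.cube c R).ncard : ℝ) ≤
              (2 * R + 1) ^ 2 + C * GaborDensity.crossIntegral
                (GaborDensity.stft GaborDensity.gaussianWindow g) (R + 1 / 4)) ∧
        (GaborDensity.IsFrame (GaborDensity.gaborSystem g Λ) A B →
          ∀ R : ℝ, 1 / 2 ≤ R → ∀ c : ℝ × ℝ,
            (Λ ∩ GaborDensity.cube c R).Finite ∧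
            (2 * R - 1) ^ 2 - C * GaborDensity.crossIntegral
                (GaborDensity.stft GaborDensity.gaussianWindow g) (R - 1 / 2) ≤
              ((Λ ∩ GaborDensity.cube c R).ncard : ℝ)) := by
  -- The ellipse radius: `δ / 2` makes the ellipses disjoint, `1/4` keeps them within the margin.
  have hr : 0 < min (δ / 2) (1 / 4) := by positivity
  refine ⟨Real.exp (2 * min (δ / 2) (1 / 4) ^ 2) / (A * min (δ / 2) (1 / 4) ^ 2), by positivity,
    fun g Λ hΛ => ?_⟩
  have hfin : ∀ c R, {p : Λ | (p : ℝ × ℝ) ∈ GaborDensity.cube c R}.Finite := fun c R =>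
    Set.Finite.of_finite_image ((hΛ.finite_inter_cube hδ c R).subset (by
      rintro _ ⟨p, hp, rfl⟩
      exact ⟨p.2, hp⟩)) Subtype.val_injective.injOn
  have hs : ∀ c R (p : Λ), p ∈ (hfin c R).toFinset ↔ (p : ℝ × ℝ) ∈ GaborDensity.cube c R :=
    fun c R p => (hfin c R).mem_toFinset
  refine ⟨fun hf R hR c => ⟨hΛ.finite_inter_cube hδ c R, ?_⟩,
    fun hf R hR c => ⟨hΛ.finite_inter_cube hδ c R, ?_⟩⟩
  · rw [GaborDensity.ncard_inter_cube _ (hs c R)]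
    exact GaborDensity.ncard_le_of_isRieszSequence hδ hA hr (min_le_left _ _) (min_le_right _ _)
      hΛ hf hR c _ (hs c R)
  · rw [GaborDensity.ncard_inter_cube _ (hs c R)]
    exact GaborDensity.le_ncard_of_isFrame hδ hA hr (min_le_left _ _) (min_le_right _ _)
      hΛ hf hR c _ (hs c R)
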